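/- Let $k$ be a number field with $l_1$ real and $l_2$ complex archimedean places, with completions $k_\nu$, and let $k_\infty=\prod_{\nu\mid\infty}k_\nu$. Let $q$ be a nondegenerate ternary quadratic form over $k$ (with $\det q$ the determinant of its Gram matrix) and let $m\in k^\times$ be such that $-m\det q\in (k^\times)^2$. Let $\mathbf X=\{q=m\}\subset\mathbf A^3_k$, on which $\mathbf G=\mathrm{SL}_2\cong\mathrm{Spin}_q$ acts through the universal covering $\mathrm{SL}_2\to\mathrm{SO}_q$ (a homomorphism of algebraic groups over $k$ with kernel the centre $\mu_2$). Let $x_0\in\mathbf X(k)$ be a point whose stabilizer in $\mathbf G$ is the diagonal torus $\mathbf H$. Put $G=\mathrm{SL}_2(k_\infty)$, $H=\mathbf H(k_\infty)$, so that $gH\mapsto g.x_0$ identifies $G/H$ with $\mathbf X(k_\infty)$, and let $\mathrm m_{G/H}$ be a nonzero $G$-invariant Radon measure on $G/H$. For every archimedean place $\nu$ fix Euclidean norms (Hermitian norms if $\nu$ is complex) on $k_\nu^2$ and $k_\nu^3$, and for $x\in k_\infty^n$ ($n=2,3$) let $\|x\|_{k_\infty}=\prod_{\nu\text{ real}}\|x_\nu\|\cdot\prod_{\nu\text{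 complex}}\|x_\nu\|^2$. With $e_1,e_2$ the standard basis of $k^2$, let $T_g=\|g e_1\|_{k_\infty}\|g e_2\|_{k_\infty}$, which depends only on $gH$. Define $$Z_{\log}(\tau)=\int_{G/H}\log T_g\,\|g.x_0\|_{k_\infty}^{-\tau}\,d\mathrm m_{G/H}([g]),\qquad Z(\tau)=\int_{G/H}\|g.x_0\|_{k_\infty}^{-\tau}\,d\mathrm m_{G/H}([g]).$$ Then both integrals converge absolutely for $\operatorname{Re}\tau>1$, and each of $Z_{\log}$ and $Z$ has the following properties, with $N=l_1+l_2+1$ for $Z_{\log}$ and $N=l_1+l_2$ for $Z$: 1. it has a meromorphic continuation to the half plane $\operatorname{Re}\tau>1/2$; 2. the continuation has a pole of order exactly $N$ at $\tau=1$, with $\lim_{\tau\to1}(\tau-1)^N Z_{\log}(\tau)$ (respectively $\lim_{\tau\to1}(\tau-1)^N Z(\tau)$) a positive real number, and it is analytic elsewhere in this half plane; 3. the continuation and all its derivatives have moderate growth in closed vertical strips: for all $n\ge0$ and $1/2<a\le b$ there are $C,\kappa\in\mathbb R$ such that the $n$-th derivative is bounded in absolute value by $C(1+|\operatorname{Im}\tau|)^{\kappa}$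 for all $\tau$ with $a\le\operatorname{Re}\tau\le b$ and $|\operatorname{Im}\tau|\ge1$. -/

import Mathlib

open Matrix MeasureTheory Filter Topology NumberField
open scoped ComplexOrder

universe u

noncomputable section

namespace HeightZeta

/-! ### The quadratic form and the action of `SL₂` -/

/-- The Gram matrix `A` of a ternary quadratic form `q` (away from characteristic `2`), so that
`q x = xᵀ A x`. Its determinant is the determinant of `q`. -/
def gramMatrix {k : Type u} [Field k] (q : QuadraticForm k (Fin 3 → k)) :
    Matrix (Fin 3) (Fin 3) k :=
  Matrix.of fun i j => QuadraticMap.polar q (Pi.single i 1) (Pi.single j 1) / 2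

/-- A matrix `P` of polynomials over `k` in the four entries of a `2 × 2` matrix, evaluated at a
point `g` of `SL₂(R)`, for a commutative `k`-algebra `R`. -/
def evalAt {k : Type u} [Field k] (P : Matrix (Fin 3) (Fin 3) (MvPolynomial (Fin 2 × Fin 2) k))
    (R : Type u) [CommRing R] [Algebra k R] (g : SpecialLinearGroup (Fin 2) R) :
    Matrix (Fin 3) (Fin 3) R :=
  P.map (MvPolynomial.aeval fun p : Fin 2 × Fin 2 => g.1 p.1 p.2)

/-- The universal covering `SL₂ ≅ Spin_q → SO_q ⊂ GL₃` over `k`, i.e. a homomorphism of algebraic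
groups over `k` from `SL₂` to `SO_q` whose kernel is the centre `μ₂` of `SL₂`. A morphism from the
closed subscheme `SL₂` of affine `4`-space to `3 × 3` matrices is given by a matrix of
polynomials, and the laws are those of the induced maps on `R`-points, for all commutative
`k`-algebras `R`. -/
structure SpinCover {k : Type u} [Field k] (q : QuadraticForm k (Fin 3 → k)) where
  /-- the polynomials defining the morphism -/
  poly : Matrix (Fin 3) (Fin 3) (MvPolynomial (Fin 2 × Fin 2) k)
  map_one : ∀ (R : Type u) [CommRing R] [Algebra k R],
    evalAt poly R 1 = 1
  map_mul : ∀ (R : Type u) [CommRing R] [Algebra k R] (g h : SpecialLinearGroup (Fin 2) R),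
    evalAt poly R (g * h) = evalAt poly R g * evalAt poly R h
  preserves_form : ∀ (R : Type u) [CommRing R] [Algebra k R] (g : SpecialLinearGroup (Fin 2) R),
    (evalAt poly R g)ᵀ * (gramMatrix q).map (algebraMap k R) * evalAt poly R g =
      (gramMatrix q).map (algebraMap k R)
  det_eq_one : ∀ (R : Type u) [CommRing R] [Algebra k R] (g : SpecialLinearGroup (Fin 2) R),
    (evalAt poly R g).det = 1
  ker_eq_center : ∀ (R : Type u) [CommRing R] [Algebra k R] (g : SpecialLinearGroup (Fin 2) R),
    evalAt poly R g = 1 ↔ ∃ ζ : R, ζ ^ 2 = 1 ∧ g.1 = Matrix.scalar (Fin 2) ζ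

/-- The element `diag(t, t⁻¹)` of `SL₂(R)`. -/
def diagElt (R : Type u) [CommRing R] (t : Rˣ) : SpecialLinearGroup (Fin 2) R :=
  ⟨!![(t : R), 0; 0, ((t⁻¹ : Rˣ) : R)], by simp [Matrix.det_fin_two]⟩

/-- The diagonal torus `H(R) = {diag(t, t⁻¹) : t ∈ Rˣ}` of `SL₂(R)`. -/
def diagTorus (R : Type u) [CommRing R] : Subgroup (SpecialLinearGroup (Fin 2) R) where
  carrier := Set.range (diagElt R)
  one_mem' := ⟨1, Subtype.ext (by simp [diagElt, Matrix.one_fin_two])⟩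
  mul_mem' := by
    rintro _ _ ⟨s, rfl⟩ ⟨t, rfl⟩
    refine ⟨s * t, Subtype.ext ?_⟩
    change !![_, 0; 0, _] = !![(s : R), 0; 0, _] * !![(t : R), 0; 0, _]
    simp [mul_comm]
  inv_mem' := by
    rintro _ ⟨t, rfl⟩
    refine ⟨t⁻¹, Subtype.ext ?_⟩
    change !![_, 0; 0, _] = Matrix.adjugate !![(t : R), 0; 0, _]
    simp [Matrix.adjugate_fin_two]

variable {k : Type u} [Field k]

/-- The action of `g ∈ SL₂(R)` on a `k`-rational vector, with values in `R³`. -/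
def SpinCover.act {q : QuadraticForm k (Fin 3 → k)} (ρ : SpinCover q)
    (R : Type u) [CommRing R] [Algebra k R] (g : SpecialLinearGroup (Fin 2) R) (x : Fin 3 → k) :
    Fin 3 → R :=
  evalAt ρ.poly R g *ᵥ fun i => algebraMap k R (x i)

/-- The stabilizer of `x₀`, as an algebraic subgroup of `SL₂`, is the diagonal torus. -/
def SpinCover.StabilizerIsTorus {q : QuadraticForm k (Fin 3 → k)} (ρ : SpinCover q)
    (x₀ : Fin 3 → k) : Prop :=
  ∀ (R : Type u) [CommRing R] [Algebra k R] (g : SpecialLinearGroup (Fin 2) R),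
    ρ.act R g x₀ = (fun i => algebraMap k R (x₀ i)) ↔ g ∈ diagTorus R

/-! ### The groups `G = SL₂(k_∞)` and `H`, and the homogeneous space `G/H` -/

variable (k) in
/-- `G = SL₂(k_∞)`, where `k_∞` is the product of the archimedean completions of `k`. -/
abbrev G : Type u := SpecialLinearGroup (Fin 2) (InfiniteAdeleRing k)

variable (k) in
/-- `H`, the diagonal torus of `G`. -/
abbrev H : Subgroup (G k) := diagTorus (InfiniteAdeleRing k)

/-- The map `G/H → X(k_∞) ⊂ k_∞³`, `gH ↦ g.x₀`. -/
def orbitMap {q : QuadraticForm k (Fin 3 → k)} (ρ : SpinCover q) (x₀ : Fin 3 → k)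
    (hx₀ : ρ.StabilizerIsTorus x₀) : G k ⧸ H k → Fin 3 → InfiniteAdeleRing k :=
  Quotient.lift (fun g : G k => ρ.act (InfiniteAdeleRing k) g x₀) (by
    intro g g' hgg'
    have hmem : g⁻¹ * g' ∈ H k := QuotientGroup.leftRel_apply.mp hgg'
    have hfix := (hx₀ (InfiniteAdeleRing k) (g⁻¹ * g')).mpr hmem
    have hg' : g' = g * (g⁻¹ * g') := by group
    change ρ.act _ g x₀ = ρ.act _ g' x₀
    rw [hg']
    simp only [SpinCover.act] at hfix ⊢
    rw [ρ.map_mul, ← Matrix.mulVec_mulVec, hfix])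

/-! ### Heights -/

/-- The norm on `k_v^n` given by the positive definite Hermitian matrix `A` through the embedding
`σ_v : k_v → ℂ`, i.e. `‖x‖ = (σ_v(x)* A σ_v(x))^{1/2}`. When `v` is real, this is an arbitrary
Euclidean norm on `k_v^n ≅ ℝ^n`; when `v` is complex, it is an arbitrary Hermitian norm on
`k_v^n ≅ ℂ^n`. -/
def localNorm {n : ℕ} (v : InfinitePlace k) (A : Matrix (Fin n) (Fin n) ℂ)
    (x : Fin n → v.Completion) : ℝ :=
  Real.sqrt (star (fun i => InfinitePlace.Completion.extensionEmbedding v (x i)) ⬝ᵥ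
    (A *ᵥ fun i => InfinitePlace.Completion.extensionEmbedding v (x i))).re

/-- `‖x‖_{k_∞}`, the product over the real places of the local norms and over the complex places
of the squares of the local norms. -/
def height [NumberField k] {n : ℕ} (A : InfinitePlace k → Matrix (Fin n) (Fin n) ℂ)
    (x : Fin n → InfiniteAdeleRing k) : ℝ :=
  ∏ v : InfinitePlace k, localNorm v (A v) (fun i => x i v) ^ v.mult

/-- `T_g = ‖g e₁‖_{k_∞} ‖g e₂‖_{k_∞}` for `g ∈ G`. -/
def heightT [NumberField k] (A : InfinitePlace k → Matrix (Fin 2) (Fin 2) ℂ) (g : G k) : ℝ :=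
  height A (g.1 *ᵥ Pi.single 0 1) * height A (g.1 *ᵥ Pi.single 1 1)

theorem localNorm_smul {n : ℕ} (v : InfinitePlace k) (A : Matrix (Fin n) (Fin n) ℂ)
    (t : v.Completion) (x : Fin n → v.Completion) :
    localNorm v A (fun i => t * x i) =
      ‖InfinitePlace.Completion.extensionEmbedding v t‖ * localNorm v A x := by
  unfold localNorm
  set σ := InfinitePlace.Completion.extensionEmbedding v
  have h1 : (fun i => σ (t * x i)) = σ t • (fun i => σ (x i)) := by
    ext i; simp
  rw [h1, star_smul, Matrix.mulVec_smul, smul_dotProduct, dotProduct_smul, smul_smul]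
  have h2 : star (σ t) * σ t = ((‖σ t‖ ^ 2 : ℝ) : ℂ) := by
    rw [Complex.star_def, mul_comm, Complex.mul_conj, Complex.normSq_eq_norm_sq]
  rw [h2, smul_eq_mul, Complex.re_ofReal_mul, Real.sqrt_mul (by positivity),
    Real.sqrt_sq (norm_nonneg _)]

theorem height_smul [NumberField k] {n : ℕ} (A : InfinitePlace k → Matrix (Fin n) (Fin n) ℂ)
    (t : InfiniteAdeleRing k) (x : Fin n → InfiniteAdeleRing k) :
    height A (fun i => t * x i) =
      (∏ v : InfinitePlace k,
        ‖InfinitePlace.Completion.extensionEmbedding v (t v)‖ ^ v.mult) * height A x := by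
  unfold height
  rw [← Finset.prod_mul_distrib]
  refine Finset.prod_congr rfl fun v _ => ?_
  rw [← mul_pow, ← localNorm_smul]
  rfl

/-- `T_{gh} = T_g` for `h ∈ H`. -/
theorem heightT_mul_torus [NumberField k] (A : InfinitePlace k → Matrix (Fin 2) (Fin 2) ℂ)
    (g h : G k) (hh : h ∈ H k) : heightT A (g * h) = heightT A g := by
  obtain ⟨t, rfl⟩ := hh
  have e0 : (g * diagElt _ t).1 *ᵥ Pi.single 0 1 =
      fun i => (t : InfiniteAdeleRing k) * (g.1 *ᵥ Pi.single 0 1) i := by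
    ext1 i
    change ((g.1 * !![_, 0; 0, _]) *ᵥ _) i = _
    simp [Matrix.mul_apply, Fin.sum_univ_two, mul_comm]
  have e1 : (g * diagElt _ t).1 *ᵥ Pi.single 1 1 =
      fun i => ((t⁻¹ : (InfiniteAdeleRing k)ˣ) : InfiniteAdeleRing k) *
        (g.1 *ᵥ Pi.single 1 1) i := by
    ext1 i
    change ((g.1 * !![_, 0; 0, _]) *ᵥ _) i = _
    simp [Matrix.mul_apply, Fin.sum_univ_two, mul_comm]
  have key : (∏ v : InfinitePlace k,
        ‖InfinitePlace.Completion.extensionEmbedding v ((t : InfiniteAdeleRing k) v)‖ ^ v.mult) *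
      (∏ v : InfinitePlace k, ‖InfinitePlace.Completion.extensionEmbedding v
        (((t⁻¹ : (InfiniteAdeleRing k)ˣ) : InfiniteAdeleRing k) v)‖ ^ v.mult) = 1 := by
    rw [← Finset.prod_mul_distrib]
    refine Finset.prod_eq_one fun v _ => ?_
    have hv : (t : InfiniteAdeleRing k) v *
        ((t⁻¹ : (InfiniteAdeleRing k)ˣ) : InfiniteAdeleRing k) v = 1 :=
      congrFun (Units.mul_inv t) v
    rw [← mul_pow, ← norm_mul, ← map_mul, hv]
    simp
  unfold heightT
  rw [e0, e1, height_smul, height_smul, mul_mul_mul_comm, key, one_mul]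

/-- The function `gH ↦ T_g` on `G/H`. -/
def cosetT [NumberField k] (A : InfinitePlace k → Matrix (Fin 2) (Fin 2) ℂ) :
    G k ⧸ H k → ℝ :=
  Quotient.lift (heightT A) (by
    intro g g' hgg'
    have hmem : g⁻¹ * g' ∈ H k := QuotientGroup.leftRel_apply.mp hgg'
    have hg' : g' = g * (g⁻¹ * g') := by group
    rw [hg', heightT_mul_torus A g _ hmem])

/-! ### The height zeta functions -/

/-- The integrand `‖g.x₀‖_{k_∞}^{-τ}` of `Z(τ)`. -/
def zetaIntegrand [NumberField k] {q : QuadraticForm k (Fin 3 → k)} (ρ : SpinCover q)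
    (x₀ : Fin 3 → k) (hx₀ : ρ.StabilizerIsTorus x₀)
    (A₃ : InfinitePlace k → Matrix (Fin 3) (Fin 3) ℂ) (τ : ℂ) (y : G k ⧸ H k) : ℂ :=
  (height A₃ (orbitMap ρ x₀ hx₀ y) : ℂ) ^ (-τ)

/-- The integrand `log T_g · ‖g.x₀‖_{k_∞}^{-τ}` of `Z_log(τ)`. -/
def zetaLogIntegrand [NumberField k] {q : QuadraticForm k (Fin 3 → k)} (ρ : SpinCover q)
    (x₀ : Fin 3 → k) (hx₀ : ρ.StabilizerIsTorus x₀)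
    (A₂ : InfinitePlace k → Matrix (Fin 2) (Fin 2) ℂ)
    (A₃ : InfinitePlace k → Matrix (Fin 3) (Fin 3) ℂ) (τ : ℂ) (y : G k ⧸ H k) : ℂ :=
  (Real.log (cosetT A₂ y) : ℂ) * zetaIntegrand ρ x₀ hx₀ A₃ τ y

/-- The integral `Z(τ) = ∫ f τ dμ` converges absolutely for `Re τ > 1`, and it continues to a
function `F` on the half plane `Re τ > 1/2` such that `F` is meromorphic there; `F` has a pole of
order exactly `N` at `τ = 1`, with a positive real leading Laurent coefficient `c`, and is analytic
elsewhere in that half plane; and `F` and all its derivatives grow at most polynomially in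
`|Im τ|`, as `|Im τ| → ∞`, in every closed vertical strip contained in that half plane. -/
def ContinuesWithPole {Y : Type*} [MeasurableSpace Y] (μ : Measure Y) (f : ℂ → Y → ℂ) (N : ℕ) :
    Prop :=
  ∃ F : ℂ → ℂ,
    (∀ τ : ℂ, 1 < τ.re → Integrable (f τ) μ ∧ F τ = ∫ y, f τ y ∂μ) ∧
    MeromorphicOn F {τ : ℂ | 1 / 2 < τ.re} ∧
    AnalyticOnNhd ℂ F ({τ : ℂ | 1 / 2 < τ.re} \ {1}) ∧
    meromorphicOrderAt F 1 = ((-(N : ℤ) : ℤ) : WithTop ℤ) ∧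
    (∃ c : ℝ, 0 < c ∧ Tendsto (fun τ : ℂ => (τ - 1) ^ N * F τ) (𝓝[≠] 1) (𝓝 (c : ℂ))) ∧
    (∀ (n : ℕ) (a b : ℝ), 1 / 2 < a → a ≤ b →
      ∃ C κ : ℝ, ∀ τ : ℂ, a ≤ τ.re → τ.re ≤ b → 1 ≤ |τ.im| →
        ‖iteratedDeriv n F τ‖ ≤ C * (1 + |τ.im|) ^ κ)

end HeightZeta

end

/-! Sending `gH` to the line spanned by `g e₁` fibres `G/H` over a product of projective lines, one
for each archimedean place, with affine lines as fibres. In the chart `n⁻(x) n⁺(y) H` the base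
coordinate is `x` and the fibre coordinate is `y`. Swapping coordinates by Weyl elements at a subset
of the places covers `G/H` by finitely many disjoint pieces on which every `x_v` runs over a unit
ball. On each piece an invariant measure is one and the same constant times Haar measure in all the
`x_v` and `y_v` (`exists_eq_smul_sum_map_piChart`), so the integral of a product of local functions
becomes a product of local integrals.

The orbit map is affine along the fibres: `n⁺(y) x₀ = x₀ + y w` with `w ≠ 0`
(`SpinCover.exists_act_upperElt`). Hence the local height on a fibre is the norm of `P(x) + y Q(x)`,
a line missing the origin. With `ℓ(y) = mult · log max(1, |y|)`, the logarithm of the normalised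
height is `α(x) + ℓ(y) + O(e^{-ℓ/2})`, uniformly for `x` in the unit ball
(`LineFamily.exists_abs_log_sub_le`). The set `{ℓ ≤ u}` has Haar measure exactly `v e^u`, so
replacing the height by `exp (α + ℓ)` gives the explicit integral `(∫ e^{-τα}) · vτ/(τ-1)`. The
error has integrand `O((1+ℓ) e^{-(Re τ + 1/2) ℓ})`, locally uniformly in `Re τ`, which is integrable
against this growth exactly when `Re τ > 1/2`; this is the source of the half plane
(`moderateGrowth_integral_sub`). Each place therefore contributes a simple pole with positive
leading coefficient.

For the weighted integral, `log T_g` is a sum of local terms, each of the form `β(x) + ℓ(y) +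
O(e^{-ℓ/2})`, because `g e₁` is constant on a fibre while `g e₂` runs over a line. A factor `ℓ`
raises the local pole to order two (`hasPoleAtOne_mul_exp`). Each summand thus has total order one
more than the number of places, and the leading coefficients, all being positive, cannot cancel
(`HasPoleAtOne.pi_sum`). -/

namespace HeightZeta

/-! ### Functions of moderate growth and poles at `τ = 1` -/

/-- Holomorphic functions on `Re τ > 1/2` of polynomial growth in closed vertical strips. -/
structure ModerateGrowth (H : ℂ → ℂ) : Prop where
  differentiableOn : DifferentiableOn ℂ H {τ : ℂ | 1 / 2 < τ.re}
  bound : ∀ a b : ℝ, 1 / 2 < a → ∃ (C : ℝ) (n : ℕ), 0 ≤ C ∧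
    ∀ τ : ℂ, a ≤ τ.re → τ.re ≤ b → ‖H τ‖ ≤ C * (1 + |τ.im|) ^ n

theorem isOpen_halfPlane : IsOpen {τ : ℂ | 1 / 2 < τ.re} :=
  isOpen_lt continuous_const Complex.continuous_re

namespace ModerateGrowth

theorem const (c : ℂ) : ModerateGrowth fun _ => c :=
  ⟨differentiableOn_const c, fun _ _ _ => ⟨‖c‖, 0, norm_nonneg _, by simp⟩⟩

theorem id : ModerateGrowth fun τ => τ := by
  refine ⟨differentiableOn_id, fun a b ha => ⟨1 + |b|, 1, by positivity, fun τ h1 h2 => ?_⟩⟩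
  have h3 := Complex.norm_le_abs_re_add_abs_im τ
  have h4 : |τ.re| ≤ |b| := by
    rw [abs_of_pos (by linarith)]
    exact h2.trans (le_abs_self b)
  nlinarith [abs_nonneg τ.im, abs_nonneg b]

variable {F G : ℂ → ℂ}

theorem add (hF : ModerateGrowth F) (hG : ModerateGrowth G) :
    ModerateGrowth fun τ => F τ + G τ := by
  refine ⟨hF.1.add hG.1, fun a b ha => ?_⟩
  obtain ⟨C, n, hC, h⟩ := hF.2 a b ha
  obtain ⟨D, m, hD, h'⟩ := hG.2 a b ha
  refine ⟨C + D, n + m, by positivity, fun τ h1 h2 => (norm_add_le _ _).trans ?_⟩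
  have one : (1 : ℝ) ≤ 1 + |τ.im| := by linarith [abs_nonneg τ.im]
  rw [add_mul]
  refine add_le_add ((h τ h1 h2).trans ?_) ((h' τ h1 h2).trans ?_)
  · exact mul_le_mul_of_nonneg_left (pow_le_pow_right₀ one (by omega)) hC
  · exact mul_le_mul_of_nonneg_left (pow_le_pow_right₀ one (by omega)) hD

theorem mul (hF : ModerateGrowth F) (hG : ModerateGrowth G) :
    ModerateGrowth fun τ => F τ * G τ := by
  refine ⟨hF.1.mul hG.1, fun a b ha => ?_⟩
  obtain ⟨C, n, hC, h⟩ := hF.2 a b ha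
  obtain ⟨D, m, hD, h'⟩ := hG.2 a b ha
  refine ⟨C * D, n + m, by positivity, fun τ h1 h2 => ?_⟩
  rw [norm_mul, pow_add, mul_mul_mul_comm]
  exact mul_le_mul (h τ h1 h2) (h' τ h1 h2) (norm_nonneg _) (by positivity)

theorem sum {ι : Type*} (s : Finset ι) {f : ι → ℂ → ℂ} (hf : ∀ i ∈ s, ModerateGrowth (f i)) :
    ModerateGrowth fun τ => ∑ i ∈ s, f i τ := by
  classical
  induction s using Finset.induction_on with
  | empty => simpa using const 0
  | insert i s hi ih =>
    simp only [Finset.sum_insert hi]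
    exact (hf i (by simp)).add (ih fun j hj => hf j (by simp [hj]))

theorem prod {ι : Type*} (s : Finset ι) {f : ι → ℂ → ℂ} (hf : ∀ i ∈ s, ModerateGrowth (f i)) :
    ModerateGrowth fun τ => ∏ i ∈ s, f i τ := by
  classical
  induction s using Finset.induction_on with
  | empty => simpa using const 1
  | insert i s hi ih =>
    simp only [Finset.prod_insert hi]
    exact (hf i (by simp)).mul (ih fun j hj => hf j (by simp [hj]))

theorem analyticOnNhd (hF : ModerateGrowth F) : AnalyticOnNhd ℂ F {τ : ℂ | 1 / 2 < τ.re} :=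
  hF.1.analyticOnNhd isOpen_halfPlane

/-- Derivatives of the quotient by a power of `τ - 1` have polynomial growth. -/
theorem norm_iteratedDeriv_div_pow_le (hF : ModerateGrowth F) (N n : ℕ) (a b : ℝ)
    (ha : 1 / 2 < a) :
    ∃ C κ : ℝ, ∀ τ : ℂ, a ≤ τ.re → τ.re ≤ b → 1 ≤ |τ.im| →
        ‖iteratedDeriv n (fun τ => F τ / (τ - 1) ^ N) τ‖ ≤ C * (1 + |τ.im|) ^ κ := by
  -- The discs for Cauchy's estimate must stay inside `Re z > 1/2` (second term) and at distance at
  -- least `1/2` from the pole; as `|Im τ| ≥ 1`, a radius of at most `1/2` ensures the latter.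
  set r : ℝ := min (1 / 2) ((a - 1 / 2) / 2) with hr
  have hr0 : 0 < r := by rw [hr]; exact lt_min (by norm_num) (by linarith)
  have hr1 : r ≤ 1 / 2 := min_le_left _ _
  have hr2 : r ≤ (a - 1 / 2) / 2 := min_le_right _ _
  obtain ⟨C, m, hC, h⟩ := hF.2 (a - r) (b + r) (by linarith)
  refine ⟨n.factorial * (C * 2 ^ m * 2 ^ N) / r ^ n, m, fun τ h1 h2 h3 => ?_⟩
  rw [Real.rpow_natCast]
  have hball : ∀ z ∈ Metric.closedBall τ r, a - r ≤ z.re ∧ z.re ≤ b + r ∧ 1 / 2 ≤ |z.im| ∧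
      |z.im| ≤ |τ.im| + 1 := by
    intro z hz
    rw [mem_closedBall_iff_norm] at hz
    have e1 := (Complex.abs_re_le_norm (z - τ)).trans hz
    have e2 := (Complex.abs_im_le_norm (z - τ)).trans hz
    rw [Complex.sub_re] at e1
    rw [Complex.sub_im] at e2
    have e3 := abs_le.mp e1
    have e4 := abs_sub_abs_le_abs_sub z.im τ.im
    have e5 := abs_sub_abs_le_abs_sub τ.im z.im
    rw [abs_sub_comm] at e5
    refine ⟨by linarith, by linarith, by linarith, by linarith⟩
  have hne : ∀ z ∈ Metric.closedBall τ r, 1 / 2 ≤ ‖z - 1‖ := fun z hz =>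
    (hball z hz).2.2.1.trans (by simpa using Complex.abs_im_le_norm (z - 1))
  have hd : DiffContOnCl ℂ (fun τ => F τ / (τ - 1) ^ N) (Metric.ball τ r) := by
    refine DifferentiableOn.diffContOnCl ?_
    rw [closure_ball τ hr0.ne']
    refine (hF.1.mono fun z hz => ?_).div (by fun_prop) fun z hz => ?_
    · have := (hball z hz).1
      simp only [Set.mem_ofPred_eq]
      linarith
    · refine pow_ne_zero _ fun h0 => ?_
      have := hne z hz
      rw [h0, norm_zero] at this
      norm_num at this
  refine (Complex.norm_iteratedDeriv_le_of_forall_mem_sphere_norm_le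
    (C := C * 2 ^ m * 2 ^ N * (1 + |τ.im|) ^ m) n hr0 hd fun z hz => ?_).trans_eq (by ring)
  have hz' := Metric.sphere_subset_closedBall hz
  obtain ⟨g1, g2, -, g4⟩ := hball z hz'
  have g5 := hne z hz'
  rw [norm_div, norm_pow]
  have k1 : ‖F z‖ ≤ C * (2 ^ m * (1 + |τ.im|) ^ m) := by
    refine (h z g1 g2).trans ?_
    rw [← mul_pow]
    gcongr
    linarith [abs_nonneg τ.im]
  have k2 : (2 ^ N : ℝ)⁻¹ ≤ ‖z - 1‖ ^ N := by
    rw [← inv_pow]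
    gcongr
    norm_num at g5 ⊢
    exact g5
  rw [div_le_iff₀ (lt_of_lt_of_le (by positivity) k2)]
  calc ‖F z‖ ≤ C * (2 ^ m * (1 + |τ.im|) ^ m) := k1
    _ = C * 2 ^ m * 2 ^ N * (1 + |τ.im|) ^ m * (2 ^ N : ℝ)⁻¹ := by field_simp
    _ ≤ _ := by gcongr

end ModerateGrowth

/-- `(τ - 1)^N ∫ f τ dμ` is the restriction to `Re τ > 1` of a holomorphic function of moderate
growth on `Re τ > 1/2`, with positive value at `1`. -/
def HasPoleAtOne {Y : Type*} [MeasurableSpace Y] (μ : Measure Y) (f : ℂ → Y → ℂ) (N : ℕ) : Prop :=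
  ∃ H : ℂ → ℂ, ModerateGrowth H ∧ (∃ c : ℝ, 0 < c ∧ H 1 = c) ∧
    ∀ τ : ℂ, 1 < τ.re → Integrable (f τ) μ ∧ H τ = (τ - 1) ^ N * ∫ y, f τ y ∂μ

/-- The continuation is `H τ / (τ - 1) ^ N`. As `H 1` is positive, no cancellation occurs and the
order is exactly `N`; the growth of the derivatives is Cauchy's estimate for this quotient. -/
theorem HasPoleAtOne.continuesWithPole {Y : Type*} [MeasurableSpace Y] {μ : Measure Y}
    {f : ℂ → Y → ℂ} {N : ℕ} (h : HasPoleAtOne μ f N) : ContinuesWithPole μ f N := by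
  obtain ⟨H, hH, ⟨c, hc, hc1⟩, hint⟩ := h
  have hone : (1 : ℂ) ∈ {τ : ℂ | 1 / 2 < τ.re} := by norm_num
  have han := hH.analyticOnNhd
  have hlim : Tendsto (fun τ : ℂ => (τ - 1) ^ N * (H τ / (τ - 1) ^ N)) (𝓝[≠] 1) (𝓝 (c : ℂ)) := by
    have h1 : Tendsto H (𝓝[≠] 1) (𝓝 (c : ℂ)) := by
      rw [← hc1]
      exact (han 1 hone).continuousAt.tendsto.mono_left nhdsWithin_le_nhds
    refine h1.congr' ?_
    filter_upwards [self_mem_nhdsWithin] with τ hτ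
    rw [mul_div_cancel₀]
    exact pow_ne_zero _ (sub_ne_zero.mpr hτ)
  have hmer : MeromorphicOn (fun τ => H τ / (τ - 1) ^ N) {τ : ℂ | 1 / 2 < τ.re} := fun τ hτ =>
    (han τ hτ).meromorphicAt.div (by fun_prop)
  refine ⟨fun τ => H τ / (τ - 1) ^ N, fun τ hτ => ⟨(hint τ hτ).1, ?_⟩, hmer, ?_, ?_,
    ⟨c, hc, hlim⟩, fun n a b ha _ => hH.norm_iteratedDeriv_div_pow_le N n a b ha⟩
  · simp only [(hint τ hτ).2]
    rw [mul_div_cancel_left₀]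
    refine pow_ne_zero _ (sub_ne_zero.mpr ?_)
    rintro rfl
    simp at hτ
  · rintro τ ⟨hτ, hne⟩
    exact (han τ hτ).div (by fun_prop) (pow_ne_zero _ (sub_ne_zero.mpr hne))
  · rw [meromorphicOrderAt_eq_int_iff (hmer 1 hone)]
    refine ⟨H, han 1 hone, by rw [hc1]; exact_mod_cast hc.ne', ?_⟩
    filter_upwards with τ
    rw [_root_.zpow_neg, zpow_natCast, smul_eq_mul, div_eq_mul_inv, mul_comm]

/-- Integrals of entire functions of polynomial growth depending on a parameter. -/
theorem ModerateGrowth.integral {Ω : Type*} [MeasurableSpace Ω] {μ : Measure Ω}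
    {g : ℂ → Ω → ℂ} (hg : ∀ ω, Differentiable ℂ fun τ => g τ ω)
    (hmeas : ∀ τ, AEStronglyMeasurable (g τ) μ)
    (hbound : ∀ a b : ℝ, 1 / 2 < a → ∃ (n : ℕ) (h : Ω → ℝ), Integrable h μ ∧
      ∀ᵐ ω ∂μ, ∀ τ : ℂ, a ≤ τ.re → τ.re ≤ b → ‖g τ ω‖ ≤ (1 + |τ.im|) ^ n * h ω) :
    ModerateGrowth fun τ => ∫ ω, g τ ω ∂μ := by
  constructor
  · intro τ hτ
    refine DifferentiableAt.differentiableWithinAt ?_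
    simp only [Set.mem_ofPred_eq] at hτ
    -- Discs of radius `r` around points of the disc of radius `r` at `τ` lie in the disc of radius
    -- `2r`, which is still in the half plane, so one majorant bounds all derivatives by Cauchy's
    -- estimate.
    set r : ℝ := (τ.re - 1 / 2) / 4 with hr
    have hr0 : 0 < r := by linarith
    obtain ⟨n, h, hh, hb⟩ := hbound (τ.re - 2 * r) (τ.re + 2 * r) (by linarith)
    have hb' : ∀ᵐ ω ∂μ, ∀ z ∈ Metric.closedBall τ (2 * r),
        ‖g z ω‖ ≤ (1 + |τ.im| + 2 * r) ^ n * |h ω| := by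
      filter_upwards [hb] with ω hb z hz
      rw [mem_closedBall_iff_norm] at hz
      have e1 := (Complex.abs_re_le_norm (z - τ)).trans hz
      have e2 := (Complex.abs_im_le_norm (z - τ)).trans hz
      rw [Complex.sub_re] at e1
      rw [Complex.sub_im] at e2
      have e3 := abs_le.mp e1
      have e4 := abs_sub_abs_le_abs_sub z.im τ.im
      refine (hb z (by linarith) (by linarith)).trans ?_
      exact mul_le_mul (pow_le_pow_left₀ (by positivity) (by linarith) _) (le_abs_self _)
        -- The majorant `h` is nonnegative at this `ω`, since it bounds a norm up to a positive
        -- factor.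
        (by_contra fun hneg => by
          push Not at hneg
          have h5 := hb z (by linarith) (by linarith)
          have h6 := mul_neg_of_pos_of_neg (show 0 < (1 + |z.im|) ^ n by positivity) hneg
          linarith [norm_nonneg (g z ω)]) (by positivity)
    have hderiv : ∀ᵐ ω ∂μ, ∀ z ∈ Metric.ball τ r,
        ‖deriv (fun τ => g τ ω) z‖ ≤ (1 + |τ.im| + 2 * r) ^ n * |h ω| / r := by
      filter_upwards [hb'] with ω hb' z hz
      refine Complex.norm_deriv_le_of_forall_mem_sphere_norm_le hr0
        (hg ω).diffContOnCl fun w hw => hb' w ?_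
      rw [Metric.mem_closedBall]
      have := Metric.mem_ball.mp hz
      have h2 := Metric.mem_sphere.mp hw
      linarith [dist_triangle w z τ]
    refine (hasDerivAt_integral_of_dominated_loc_of_deriv_le (μ := μ) (F := g)
      (F' := fun z ω => deriv (fun τ => g τ ω) z)
      (bound := fun ω => (1 + |τ.im| + 2 * r) ^ n * |h ω| / r)
      (Metric.ball_mem_nhds τ hr0) ?_ ?_ ?_ ?_ ?_ ?_).2.differentiableAt
    · exact Eventually.of_forall hmeas
    · refine (hh.abs.const_mul ((1 + |τ.im| + 2 * r) ^ n)).mono' (hmeas τ) ?_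
      exact hb'.mono fun ω hb' => hb' τ (Metric.mem_closedBall_self (by positivity))
    -- Measurability of the derivative in `ω`: it is a pointwise limit of difference quotients with
    -- steps `1/(j+1)`.
    · have hlim : Tendsto (fun (j : ℕ) ω => ((1 / ((j : ℂ) + 1)))⁻¹ * (g (τ + 1 / ((j : ℂ) + 1)) ω - g τ ω)) atTop
          (𝓝 fun ω => deriv (fun τ => g τ ω) τ) := by
        rw [tendsto_pi_nhds]
        intro ω
        have h1 := hasDerivAt_iff_tendsto_slope_zero.mp ((hg ω) τ).hasDerivAt
        refine h1.comp (tendsto_nhdsWithin_iff.mpr ⟨tendsto_one_div_add_atTop_nhds_zero_nat, ?_⟩)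
        exact Eventually.of_forall fun j => one_div_ne_zero (Nat.cast_add_one_ne_zero j)
      refine aestronglyMeasurable_of_tendsto_ae atTop (fun j => ?_)
        (Eventually.of_forall fun ω => (tendsto_pi_nhds.mp hlim) ω)
      exact ((hmeas _).sub (hmeas τ)).const_mul _
    · exact hderiv
    · exact (hh.abs.const_mul _).div_const _
    · exact Eventually.of_forall fun ω z _ => ((hg ω) z).hasDerivAt
  · intro a b ha
    obtain ⟨n, h, hh, hb⟩ := hbound a b ha
    refine ⟨|∫ ω, h ω ∂μ|, n, abs_nonneg _, fun τ h1 h2 => ?_⟩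
    refine (norm_integral_le_of_norm_le (hh.const_mul ((1 + |τ.im|) ^ n))
      (hb.mono fun ω hb => hb τ h1 h2)).trans ?_
    rw [integral_const_mul, mul_comm]
    exact mul_le_mul_of_nonneg_right (le_abs_self _) (by positivity)

/-! ### Measures of exact exponential growth -/

/-- The nonnegative function `ℓ` has exponential volume growth `η {ℓ ≤ u} = v e^u`. -/
structure ExpGrowth {E : Type*} [MeasurableSpace E] (η : Measure E) (ℓ : E → ℝ) (v : ℝ) :
    Prop where
  measurable : Measurable ℓ
  nonneg : ∀ y, 0 ≤ ℓ y
  pos : 0 < v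
  measure_le : ∀ u : ℝ, 0 ≤ u → η {y | ℓ y ≤ u} = ENNReal.ofReal (v * Real.exp u)

open Set in
theorem integrableOn_mul_exp_Ioi {a : ℂ} (ha : a.re < 0) :
    IntegrableOn (fun u : ℝ => (u : ℂ) * Complex.exp (a * u)) (Ioi 0) := by
  -- Half of the exponential decay absorbs the factor `u`, the other half remains integrable.
  have h := (integrableOn_exp_mul_Ioi (a := a.re / 2) (by linarith) 0).const_mul (-(2 / a.re))
  refine Integrable.mono' h (by fun_prop) ?_
  filter_upwards [ae_restrict_mem measurableSet_Ioi] with u hu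
  have hu0 : 0 < u := hu
  rw [norm_mul, Complex.norm_real, Complex.norm_exp, Real.norm_of_nonneg hu0.le,
    show (a * u).re = -(-(a.re / 2) * u) + a.re / 2 * u by simp; ring, Real.exp_add, ← mul_assoc]
  refine mul_le_mul_of_nonneg_right ?_ (Real.exp_nonneg _)
  have h1 : -(a.re / 2) * u ≤ Real.exp (-(a.re / 2) * u) :=
    (Real.add_one_le_exp _).trans' (by linarith)
  have hne : a.re ≠ 0 := ha.ne
  rw [Real.exp_neg, ← div_eq_mul_inv, div_le_iff₀ (Real.exp_pos _)]
  calc u = -(2 / a.re) * (-(a.re / 2) * u) := by field_simp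
    _ ≤ _ := mul_le_mul_of_nonneg_left h1
      (neg_nonneg.mpr (div_nonpos_of_nonneg_of_nonpos (by norm_num) ha.le))

open Set in
theorem integral_mul_exp_Ioi {a : ℂ} (ha : a.re < 0) :
    ∫ u : ℝ in Ioi 0, (u : ℂ) * Complex.exp (a * u) = 1 / a ^ 2 := by
  have ha0 : a ≠ 0 := by rintro rfl; simp at ha
  have hd : ∀ x : ℝ, HasDerivAt
      (fun u : ℝ => Complex.exp (a * u) * (u / a - 1 / a ^ 2)) (x * Complex.exp (a * x)) x := by
    intro x
    have h1 : HasDerivAt (fun u : ℝ => (u : ℂ)) 1 x := Complex.ofRealCLM.hasDerivAt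
    have h2 := ((h1.const_mul a).cexp).mul ((h1.div_const a).sub_const (1 / a ^ 2))
    convert! h2 using 1
    field_simp
    ring
  have hlim : Tendsto (fun u : ℝ => Complex.exp (a * u) * (u / a - 1 / a ^ 2)) atTop (𝓝 0) := by
    have h1 : Tendsto (fun u : ℝ => Complex.exp (a * u)) atTop (𝓝 0) := by
      rw [Complex.tendsto_exp_nhds_zero_iff]
      simpa using tendsto_const_nhds.neg_mul_atTop ha tendsto_id
    have h2 : Tendsto (fun u : ℝ => (u : ℂ) * Complex.exp (a * u)) atTop (𝓝 0) := by
      rw [tendsto_zero_iff_norm_tendsto_zero]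
      have h3 := (Real.tendsto_pow_mul_exp_neg_atTop_nhds_zero 1).comp
        (tendsto_id.const_mul_atTop (show 0 < -a.re by linarith))
      have h4 := h3.const_mul (1 / -a.re)
      rw [mul_zero] at h4
      refine h4.congr' ?_
      filter_upwards [eventually_gt_atTop 0] with u hu
      have : a.re ≠ 0 := ha.ne
      rw [norm_mul, Complex.norm_real, Complex.norm_exp, Real.norm_of_nonneg hu.le]
      simp
      field_simp
    have h5 := (h2.mul_const (1 / a)).sub (h1.mul_const (1 / a ^ 2))
    simp only [zero_mul, sub_zero] at h5
    refine h5.congr fun u => by ring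
  rw [integral_Ioi_of_hasDerivAt_of_tendsto (hd 0).continuousAt.continuousWithinAt
    (fun x _ => hd x) (integrableOn_mul_exp_Ioi ha) hlim]
  simp

namespace ExpGrowth

variable {E : Type*} [MeasurableSpace E] {η : Measure E} {ℓ : E → ℝ} {v : ℝ}

-- The atom at `0` records that `{ℓ = 0}` already has mass `v`; beyond it the density is the
-- derivative `v e^u`. Finite measures of half-lines determine those of half-open intervals, hence
-- the measure.
open Set in
theorem map_eq (h : ExpGrowth η ℓ v) : η.map ℓ = ENNReal.ofReal v • (Measure.dirac 0 +
    (volume.restrict (Ioi (0 : ℝ))).withDensity fun u => ENNReal.ofReal (Real.exp u)) := by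
  set ν := ENNReal.ofReal v • (Measure.dirac 0 +
    (volume.restrict (Ioi (0 : ℝ))).withDensity fun u => ENNReal.ofReal (Real.exp u)) with hν
  have hIic : ∀ b : ℝ, η.map ℓ (Iic b) = ν (Iic b) ∧ η.map ℓ (Iic b) ≠ ⊤ := by
    intro b
    rw [Measure.map_apply h.measurable measurableSet_Iic, hν, Measure.smul_apply,
      Measure.add_apply, Measure.dirac_apply' _ measurableSet_Iic,
      withDensity_apply _ measurableSet_Iic, Measure.restrict_restrict measurableSet_Iic]
    by_cases hb : 0 ≤ b
    · have e1 : ℓ ⁻¹' Iic b = {y | ℓ y ≤ b} := rfl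
      have e2 : Iic b ∩ Ioi 0 = Ioc 0 b := by ext; simp [and_comm]
      have e3 : ∫⁻ u in Ioc 0 b, ENNReal.ofReal (Real.exp u) = ENNReal.ofReal (Real.exp b - 1) := by
        rw [← ofReal_integral_eq_lintegral_ofReal]
        · rw [← intervalIntegral.integral_of_le hb, integral_exp, Real.exp_zero]
        · exact Real.continuous_exp.integrableOn_Ioc
        · exact Eventually.of_forall fun u => Real.exp_nonneg u
      rw [e1, h.measure_le b hb, e2, e3]
      refine ⟨?_, ENNReal.ofReal_ne_top⟩
      rw [indicator_of_mem (by simpa using hb), smul_eq_mul, Pi.one_apply, ← ENNReal.ofReal_one,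
        ← ENNReal.ofReal_add zero_le_one (by linarith [Real.one_le_exp hb]),
        ← ENNReal.ofReal_mul h.pos.le]
      congr 2
      ring
    · push Not at hb
      have e1 : ℓ ⁻¹' Iic b = ∅ := by
        ext y
        simpa using hb.trans_le (h.nonneg y)
      have e2 : Iic b ∩ Ioi 0 = ∅ := by
        ext y
        simp only [mem_inter_iff, mem_Iic, mem_Ioi, mem_empty_iff_false, iff_false, not_and, not_lt]
        intro h1
        linarith
      rw [e1, e2, indicator_of_notMem (by simpa using hb)]
      simp
  have hsub : ∀ a b : ℝ, Ioc a b = Iic b \ Iic a := fun a b => by ext; simp [and_comm]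
  refine Measure.ext_of_Ioc' _ _ (fun a b _ => ?_) fun a b hab => ?_
  · exact measure_ne_top_of_subset Ioc_subset_Iic_self (hIic b).2
  · rw [hsub, measure_sdiff (Iic_subset_Iic.mpr hab.le) measurableSet_Iic.nullMeasurableSet
      (hIic a).2, measure_sdiff (Iic_subset_Iic.mpr hab.le) measurableSet_Iic.nullMeasurableSet
      ((hIic a).1 ▸ (hIic a).2), (hIic a).1, (hIic b).1]

open Set in
/-- Integrals of functions of `ℓ`. -/
theorem integral_comp (h : ExpGrowth η ℓ v) {g : ℝ → ℂ} (hg : Continuous g)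
    (hint : IntegrableOn (fun u : ℝ => g u * Complex.exp u) (Ioi 0)) :
    Integrable (fun y => g (ℓ y)) η ∧
      ∫ y, g (ℓ y) ∂η = v * (g 0 + ∫ u : ℝ in Ioi 0, g u * Complex.exp u) := by
  have hd : Measurable fun u : ℝ => Real.toNNReal (Real.exp u) := by fun_prop
  have hs : ∀ u : ℝ, Real.toNNReal (Real.exp u) • g u = g u * Complex.exp u := fun u => by
    rw [NNReal.smul_def, Real.coe_toNNReal _ (Real.exp_nonneg _), Complex.real_smul,
      Complex.ofReal_exp, mul_comm]
  have hwd : Integrable g ((volume.restrict (Ioi (0 : ℝ))).withDensity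
      fun u => ENNReal.ofReal (Real.exp u)) := by
    refine (integrable_withDensity_iff_integrable_smul hd).mpr ?_
    simpa only [hs] using! hint
  have hdir : Integrable g (Measure.dirac (0 : ℝ)) := integrable_dirac (by simp)
  have hmap : Integrable g (η.map ℓ) := by
    rw [h.map_eq]
    exact (hdir.add_measure hwd).smul_measure ENNReal.ofReal_ne_top
  refine ⟨(integrable_map_measure hg.aestronglyMeasurable h.measurable.aemeasurable).mp hmap, ?_⟩
  rw [← integral_map h.measurable.aemeasurable hg.aestronglyMeasurable, h.map_eq,
    integral_smul_measure, integral_add_measure hdir hwd, integral_dirac,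
    ENNReal.toReal_ofReal h.pos.le, Complex.real_smul]
  congr 2
  refine (integral_withDensity_eq_integral_smul hd g).trans ?_
  simp only [hs]

/-- The atom and the density give `v (1 + 1/(τ - 1))`. -/
theorem integral_exp (h : ExpGrowth η ℓ v) {τ : ℂ} (hτ : 1 < τ.re) :
    Integrable (fun y => Complex.exp (-τ * ℓ y)) η ∧
      ∫ y, Complex.exp (-τ * ℓ y) ∂η = v * τ / (τ - 1) := by
  have e : ∀ u : ℝ, Complex.exp (-τ * u) * Complex.exp u = Complex.exp ((1 - τ) * u) := fun u => by
    rw [← Complex.exp_add]; congr 1; ring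
  have hre : (1 - τ).re < 0 := by simpa using hτ
  have hne : τ - 1 ≠ 0 := by rintro h0; rw [sub_eq_zero.mp h0] at hτ; simp at hτ
  have hne' : 1 - τ ≠ 0 := by rw [← neg_sub]; exact neg_ne_zero.mpr hne
  obtain ⟨h1, h2⟩ := h.integral_comp (g := fun u => Complex.exp (-τ * u)) (by fun_prop)
    (by simpa only [e] using! integrableOn_exp_mul_complex_Ioi hre 0)
  refine ⟨h1, h2.trans ?_⟩
  simp only [e]
  rw [integral_exp_mul_complex_Ioi hre]
  simp only [Complex.ofReal_zero, mul_zero, Complex.exp_zero]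
  field_simp
  ring

/-- Here the atom at `0` contributes nothing, and the extra factor `ℓ` turns the simple pole into a
double one. -/
theorem integral_mul_exp (h : ExpGrowth η ℓ v) {τ : ℂ} (hτ : 1 < τ.re) :
    Integrable (fun y => (ℓ y : ℂ) * Complex.exp (-τ * ℓ y)) η ∧
      ∫ y, (ℓ y : ℂ) * Complex.exp (-τ * ℓ y) ∂η = v / (τ - 1) ^ 2 := by
  have e : ∀ u : ℝ, u * Complex.exp (-τ * u) * Complex.exp u = u * Complex.exp ((1 - τ) * u) :=
    fun u => by
      rw [mul_assoc, ← Complex.exp_add]; congr 2; ring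
  have hre : (1 - τ).re < 0 := by simpa using hτ
  obtain ⟨h1, h2⟩ := h.integral_comp (g := fun u => u * Complex.exp (-τ * u)) (by fun_prop)
    (by simpa only [e] using! integrableOn_mul_exp_Ioi hre)
  refine ⟨h1, h2.trans ?_⟩
  simp only [e]
  rw [integral_mul_exp_Ioi hre, show (1 - τ) ^ 2 = (τ - 1) ^ 2 by ring]
  simp [div_eq_mul_inv]

theorem integrable_one_add_mul_exp (h : ExpGrowth η ℓ v) {σ : ℝ} (hσ : 1 < σ) :
    Integrable (fun y => (1 + ℓ y) * Real.exp (-σ * ℓ y)) η := by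
  have h1 := (h.integral_exp (τ := σ) (by simpa using hσ)).1
  have h2 := (h.integral_mul_exp (τ := σ) (by simpa using hσ)).1
  refine (h1.add h2).re.congr (Eventually.of_forall fun y => ?_)
  have e : Complex.exp (-(σ : ℂ) * ℓ y) = ((Real.exp (-σ * ℓ y) : ℝ) : ℂ) := by push_cast; rfl
  simp only [Pi.add_apply, e]
  rw [← Complex.ofReal_mul, ← Complex.ofReal_add]
  simp only [RCLike.re_to_complex, Complex.ofReal_re]
  ring

end ExpGrowth

/-! ### Comparison of a height with its asymptotic model -/

theorem norm_exp_sub_exp_le {z w : ℂ} {c : ℝ} (hz : z.re ≤ c) (hw : w.re ≤ c) :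
    ‖Complex.exp z - Complex.exp w‖ ≤ Real.exp c * ‖z - w‖ := by
  refine (convex_halfSpace_re_le c).norm_image_sub_le_of_norm_hasDerivWithin_le
    (f' := Complex.exp) (fun x _ => (Complex.hasDerivAt_exp x).hasDerivWithinAt) (fun x hx => ?_)
    hw hz
  rw [Complex.norm_exp]
  exact Real.exp_le_exp.mpr hx

/-- Both exponents are within `2C` of `L`, so each exponential is `O(e^{-aL})`; the differences of
weights and of exponents each save a further `e^{-L/2}`. The factor `1 + |Im τ|` comes from `‖τ‖` in
the mean value estimate for `exp`. -/
theorem norm_mul_exp_sub_mul_exp_le {L φ φ₀ w w₀ C a b : ℝ} {τ : ℂ} (hL : 0 ≤ L) (hC : 0 ≤ C)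
    (h1 : |w - w₀| ≤ C * Real.exp (-L / 2)) (h2 : |w₀| ≤ C * (1 + L))
    (h3 : |φ - φ₀| ≤ C * Real.exp (-L / 2)) (h4 : |φ₀ - L| ≤ C)
    (ha : 0 < a) (hτ : a ≤ τ.re) (hτ' : τ.re ≤ b) :
    ‖(w : ℂ) * Complex.exp (-τ * φ) - w₀ * Complex.exp (-τ * φ₀)‖ ≤
      (1 + |τ.im|) * ((C + C * C * (1 + b)) * Real.exp (2 * C * b) *
        ((1 + L) * Real.exp (-(a + 1 / 2) * L))) := by
  have hb : 0 < b := by linarith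
  have hexp : Real.exp (-L / 2) ≤ 1 := Real.exp_le_one_iff.mpr (by linarith)
  have h5 : |φ - φ₀| ≤ C := h3.trans (by nlinarith)
  have g4 := abs_le.mp h4
  have g5 := abs_le.mp h5
  have hlow : ∀ x : ℝ, L - 2 * C ≤ x → (-τ * x).re ≤ 2 * C * b - a * L := by
    intro x hx
    have e : (-τ * (x : ℂ)).re = -(τ.re * x) := by simp
    have e1 : τ.re * (L - 2 * C) ≤ τ.re * x := mul_le_mul_of_nonneg_left hx (by linarith)
    have e2 : a * L ≤ τ.re * L := mul_le_mul_of_nonneg_right hτ hL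
    have e3 : τ.re * C ≤ b * C := mul_le_mul_of_nonneg_right hτ' hC
    rw [e]
    linarith
  have k1 : ‖Complex.exp (-τ * φ)‖ ≤ Real.exp (2 * C * b - a * L) := by
    rw [Complex.norm_exp]
    exact Real.exp_le_exp.mpr (hlow φ (by linarith))
  have k2 := norm_exp_sub_exp_le (hlow φ (by linarith)) (hlow φ₀ (by linarith))
  have k3 : ‖-τ * (φ : ℂ) - -τ * (φ₀ : ℂ)‖ = ‖τ‖ * |φ - φ₀| := by
    rw [← mul_sub, norm_mul, norm_neg, ← Complex.ofReal_sub, Complex.norm_real, Real.norm_eq_abs]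
  have k4 : ‖τ‖ ≤ (1 + b) * (1 + |τ.im|) := by
    have := Complex.norm_le_abs_re_add_abs_im τ
    rw [abs_of_pos (show 0 < τ.re by linarith)] at this
    nlinarith [abs_nonneg τ.im]
  rw [k3] at k2
  have e1 : Real.exp (2 * C * b - a * L) * Real.exp (-L / 2) =
      Real.exp (2 * C * b) * Real.exp (-(a + 1 / 2) * L) := by
    rw [← Real.exp_add, ← Real.exp_add]; congr 1; ring
  set R := Real.exp (2 * C * b - a * L) with hR
  set e := Real.exp (-L / 2) with he
  have hR0 : 0 < R := Real.exp_pos _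
  have he0 : 0 < e := Real.exp_pos _
  have him : 0 ≤ |τ.im| := abs_nonneg _
  -- One difference at a time: first the weights, then the exponents.
  have split : (w : ℂ) * Complex.exp (-τ * φ) - w₀ * Complex.exp (-τ * φ₀) =
      ((w - w₀ : ℝ) : ℂ) * Complex.exp (-τ * φ) +
        w₀ * (Complex.exp (-τ * φ) - Complex.exp (-τ * φ₀)) := by
    push_cast; ring
  rw [split]
  calc _ ≤ |w - w₀| * ‖Complex.exp (-τ * φ)‖ +
        |w₀| * ‖Complex.exp (-τ * φ) - Complex.exp (-τ * φ₀)‖ := by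
        refine (norm_add_le _ _).trans_eq ?_
        rw [norm_mul, norm_mul, Complex.norm_real, Complex.norm_real, Real.norm_eq_abs,
          Real.norm_eq_abs]
    _ ≤ (C * e) * R + (C * (1 + L)) * (R * (((1 + b) * (1 + |τ.im|)) * (C * e))) := by
        gcongr
        exact k2.trans (by gcongr)
    _ = R * e * (C + C * C * (1 + b) * ((1 + L) * (1 + |τ.im|))) := by ring
    _ ≤ R * e * (C * ((1 + L) * (1 + |τ.im|)) + C * C * (1 + b) * ((1 + L) * (1 + |τ.im|))) := by
        have : (1 : ℝ) ≤ (1 + L) * (1 + |τ.im|) := by nlinarith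
        have := mul_le_mul_of_nonneg_left this hC
        gcongr
        linarith
    _ = _ := by rw [e1]; ring

/-- The majorant decays like `(1 + L) e^{-(a + 1/2) L}`, and `hint` makes it integrable as soon as
`a + 1/2 > 1`. The difference is thus holomorphic past the abscissa of convergence of either term.
-/
theorem moderateGrowth_integral_sub {Ω : Type*} [MeasurableSpace Ω] {P : Measure Ω}
    {L φ φ₀ w w₀ : Ω → ℝ} {C : ℝ} (hL : ∀ ω, 0 ≤ L ω)
    (hint : ∀ σ : ℝ, 1 < σ → Integrable (fun ω => (1 + L ω) * Real.exp (-σ * L ω)) P)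
    (hφ : Measurable φ) (hφ₀ : Measurable φ₀) (hw : Measurable w) (hw₀ : Measurable w₀)
    (hC : 0 ≤ C)
    (h1 : ∀ᵐ ω ∂P, |w ω - w₀ ω| ≤ C * Real.exp (-L ω / 2))
    (h2 : ∀ᵐ ω ∂P, |w₀ ω| ≤ C * (1 + L ω))
    (h3 : ∀ᵐ ω ∂P, |φ ω - φ₀ ω| ≤ C * Real.exp (-L ω / 2))
    (h4 : ∀ᵐ ω ∂P, |φ₀ ω - L ω| ≤ C) :
    ModerateGrowth (fun τ => ∫ ω, ((w ω : ℂ) * Complex.exp (-τ * φ ω) -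
        w₀ ω * Complex.exp (-τ * φ₀ ω)) ∂P) ∧
      ∀ τ : ℂ, 1 / 2 < τ.re → Integrable (fun ω => (w ω : ℂ) * Complex.exp (-τ * φ ω) -
        w₀ ω * Complex.exp (-τ * φ₀ ω)) P := by
  have hmeas : ∀ τ : ℂ, AEStronglyMeasurable (fun ω => (w ω : ℂ) * Complex.exp (-τ * φ ω) -
      w₀ ω * Complex.exp (-τ * φ₀ ω)) P := fun τ => by
    refine Measurable.aestronglyMeasurable ?_
    fun_prop
  have hbound : ∀ a b : ℝ, 1 / 2 < a → ∃ (n : ℕ) (h : Ω → ℝ), Integrable h P ∧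
      ∀ᵐ ω ∂P, ∀ τ : ℂ, a ≤ τ.re → τ.re ≤ b → ‖(w ω : ℂ) * Complex.exp (-τ * φ ω) -
        w₀ ω * Complex.exp (-τ * φ₀ ω)‖ ≤ (1 + |τ.im|) ^ n * h ω := by
    intro a b ha
    refine ⟨1, _, (hint (a + 1 / 2) (by linarith)).const_mul
      ((C + C * C * (1 + b)) * Real.exp (2 * C * b)), ?_⟩
    filter_upwards [h1, h2, h3, h4] with ω g1 g2 g3 g4 τ hτ hτ'
    rw [pow_one]
    exact norm_mul_exp_sub_mul_exp_le (hL ω) hC g1 g2 g3 g4 (by linarith) hτ hτ'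
  refine ⟨ModerateGrowth.integral (fun ω => by fun_prop) hmeas hbound, fun τ hτ => ?_⟩
  obtain ⟨n, h, hh, hb⟩ := hbound τ.re τ.re hτ
  exact (hh.const_mul ((1 + |τ.im|) ^ n)).mono' (hmeas τ) (hb.mono fun ω h => h τ le_rfl le_rfl)

/-- For bounded `α` and `β` on a finite measure space the integral is bounded on vertical strips of
the half plane: this is the factor of the main term coming from the base coordinate. -/
theorem moderateGrowth_integral_mul_exp {X : Type*} [MeasurableSpace X] {m : Measure X}
    [IsFiniteMeasure m] {α β : X → ℝ} {A : ℝ} (hα : Measurable α) (hβ : Measurable β)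
    (hαA : ∀ᵐ x ∂m, |α x| ≤ A) (hβA : ∀ᵐ x ∂m, |β x| ≤ A) :
    ModerateGrowth (fun τ => ∫ x, (β x : ℂ) * Complex.exp (-τ * α x) ∂m) ∧
      ∀ τ : ℂ, 1 / 2 < τ.re → Integrable (fun x => (β x : ℂ) * Complex.exp (-τ * α x)) m := by
  have hmeas : ∀ τ : ℂ, AEStronglyMeasurable (fun x => (β x : ℂ) * Complex.exp (-τ * α x)) m :=
    fun τ => by
      refine Measurable.aestronglyMeasurable ?_
      fun_prop
  have hbound : ∀ a b : ℝ, 1 / 2 < a → ∃ (n : ℕ) (h : X → ℝ), Integrable h m ∧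
      ∀ᵐ x ∂m, ∀ τ : ℂ, a ≤ τ.re → τ.re ≤ b →
        ‖(β x : ℂ) * Complex.exp (-τ * α x)‖ ≤ (1 + |τ.im|) ^ n * h x := by
    intro a b ha
    refine ⟨0, fun _ => A * Real.exp (b * A), integrable_const _, ?_⟩
    filter_upwards [hαA, hβA] with x g1 g2 τ hτ hτ'
    have hA : 0 ≤ A := (abs_nonneg _).trans g1
    rw [pow_zero, one_mul, norm_mul, Complex.norm_real, Real.norm_eq_abs, Complex.norm_exp]
    have e : (-τ * (α x : ℂ)).re = τ.re * -α x := by simp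
    rw [e]
    have e1 : τ.re * -α x ≤ τ.re * A :=
      mul_le_mul_of_nonneg_left (by linarith [(abs_le.mp g1).1]) (by linarith)
    have e2 : τ.re * A ≤ b * A := mul_le_mul_of_nonneg_right hτ' hA
    exact mul_le_mul g2 (Real.exp_le_exp.mpr (e1.trans e2)) (Real.exp_nonneg _) hA
  refine ⟨ModerateGrowth.integral (fun ω => by fun_prop) hmeas hbound, fun τ hτ => ?_⟩
  obtain ⟨n, h, hh, hb⟩ := hbound τ.re τ.re hτ
  exact (hh.const_mul ((1 + |τ.im|) ^ n)).mono' (hmeas τ) (hb.mono fun ω h => h τ le_rfl le_rfl)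

/-! ### Local zeta integrals -/

section Local

variable {X E : Type*} [MeasurableSpace X] [MeasurableSpace E] {m : Measure X} [IsFiniteMeasure m]
  {η : Measure E} [SFinite η] {ℓ : E → ℝ} {v : ℝ}

theorem exists_pos_integral_exp_eq (hm : m ≠ 0) {α : X → ℝ} {A : ℝ} (hα : Measurable α)
    (hαA : ∀ᵐ x ∂m, |α x| ≤ A) :
    ∃ c : ℝ, 0 < c ∧ ∫ x, Complex.exp (-1 * α x) ∂m = c := by
  refine ⟨∫ x, Real.exp (-α x) ∂m, ?_, ?_⟩
  · have : NeZero m := ⟨hm⟩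
    refine integral_exp_pos ?_
    refine Integrable.mono' (integrable_const (Real.exp A))
      (by exact Measurable.aestronglyMeasurable (by fun_prop)) ?_
    filter_upwards [hαA] with x hx
    rw [Real.norm_of_nonneg (Real.exp_nonneg _)]
    exact Real.exp_le_exp.mpr (by linarith [(abs_le.mp hx).1])
  · rw [← integral_complex_ofReal]
    congr 1 with x
    push_cast
    congr 1
    ring

/-- Local height zeta integrals, for a height `exp φ` asymptotic to `exp (α + ℓ)`. -/
theorem hasPoleAtOne_exp (hm : m ≠ 0) (h : ExpGrowth η ℓ v) {φ : X × E → ℝ} {α : X → ℝ} {A C : ℝ}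
    (hφ : Measurable φ) (hα : Measurable α) (hαA : ∀ᵐ x ∂m, |α x| ≤ A)
    (hφα : ∀ᵐ p ∂m.prod η, |φ p - (α p.1 + ℓ p.2)| ≤ C * Real.exp (-ℓ p.2 / 2)) :
    HasPoleAtOne (m.prod η) (fun τ p => Complex.exp (-τ * φ p)) 1 := by
  have hmL := h.measurable
  set D := |A| + |C| + 1 with hD
  have hD0 : 0 ≤ D := by positivity
  have hα' : ∀ᵐ p ∂m.prod η, |α p.1| ≤ A := Measure.quasiMeasurePreserving_fst.ae hαA
  obtain ⟨hE, hEint⟩ := moderateGrowth_integral_sub (P := m.prod η) (L := fun p => ℓ p.2) (φ := φ)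
    (φ₀ := fun p => α p.1 + ℓ p.2) (w := fun _ => 1) (w₀ := fun _ => 1) (C := D)
    (fun p => h.nonneg _)
    (fun σ hσ => by simpa using (integrable_const (1 : ℝ)).mul_prod (h.integrable_one_add_mul_exp hσ))
    hφ (by fun_prop) (by fun_prop) (by fun_prop) hD0
    (Eventually.of_forall fun p => by simp only [sub_self, abs_zero]; positivity)
    (Eventually.of_forall fun p => by
      have := h.nonneg p.2
      rw [abs_one]
      nlinarith [abs_nonneg A, abs_nonneg C])
    (hφα.mono fun p hp => hp.trans (by gcongr; linarith [le_abs_self C, abs_nonneg A]))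
    (hα'.mono fun p hp => by
      rw [add_sub_cancel_right]
      linarith [le_abs_self A, abs_nonneg C])
  obtain ⟨hα1, hα2⟩ := moderateGrowth_integral_mul_exp (m := m) (A := |A| + 1) (β := fun _ => 1) hα
    measurable_const (hαA.mono fun p hp => by linarith [le_abs_self A])
    (Eventually.of_forall fun p => by rw [abs_one]; linarith [abs_nonneg A])
  simp only [Complex.ofReal_one, one_mul] at hα1 hα2 hE hEint
  obtain ⟨c, hc, hc1⟩ := exists_pos_integral_exp_eq hm hα hαA
  -- This is `τ - 1` times the main term plus the error. At `τ = 1` the error drops out and `v ∫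
  -- e^{-α}` remains.
  refine ⟨fun τ => (∫ x, Complex.exp (-τ * α x) ∂m) * (v * τ) +
    (τ + (-1)) * ∫ p, (Complex.exp (-τ * φ p) -
      Complex.exp (-τ * (α p.1 + ℓ p.2 : ℝ))) ∂m.prod η,
    (hα1.mul ((ModerateGrowth.const v).mul .id)).add
      ((ModerateGrowth.id.add (.const (-1))).mul hE), ⟨c * v, mul_pos hc h.pos, ?_⟩, fun τ hτ => ?_⟩
  · simp only [hc1]
    push_cast
    ring
  · have hfac : ∀ p : X × E, Complex.exp (-τ * (α p.1 + ℓ p.2 : ℝ)) =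
        Complex.exp (-τ * α p.1) * Complex.exp (-τ * ℓ p.2) := fun p => by
      rw [← Complex.exp_add]; push_cast; congr 1; ring
    have hne : τ - 1 ≠ 0 := by rintro h0; rw [sub_eq_zero.mp h0] at hτ; simp at hτ
    have hi0 : Integrable (fun p : X × E => Complex.exp (-τ * (α p.1 + ℓ p.2 : ℝ)))
        (m.prod η) := by
      simp only [hfac]
      exact (hα2 τ (by linarith)).mul_prod (h.integral_exp hτ).1
    have hi1 := hEint τ (by linarith)
    have hi : Integrable (fun p => Complex.exp (-τ * φ p)) (m.prod η) :=
      (hi1.add hi0).congr (Eventually.of_forall fun p => by simp)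
    refine ⟨hi, ?_⟩
    beta_reduce
    rw [integral_sub hi hi0]
    simp only [hfac]
    rw [integral_prod_mul (fun x => Complex.exp (-τ * α x)) (fun y => Complex.exp (-τ * ℓ y)),
      (h.integral_exp hτ).2]
    field_simp
    ring

/-- Local height zeta integrals weighted by a function `ψ` asymptotic to `β + ℓ`. -/
theorem hasPoleAtOne_mul_exp (hm : m ≠ 0) (h : ExpGrowth η ℓ v) {φ ψ : X × E → ℝ} {α β : X → ℝ}
    {A C : ℝ} (hφ : Measurable φ) (hψ : Measurable ψ) (hα : Measurable α) (hβ : Measurable β)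
    (hαA : ∀ᵐ x ∂m, |α x| ≤ A) (hβA : ∀ᵐ x ∂m, |β x| ≤ A)
    (hφα : ∀ᵐ p ∂m.prod η, |φ p - (α p.1 + ℓ p.2)| ≤ C * Real.exp (-ℓ p.2 / 2))
    (hψβ : ∀ᵐ p ∂m.prod η, |ψ p - (β p.1 + ℓ p.2)| ≤ C * Real.exp (-ℓ p.2 / 2)) :
    HasPoleAtOne (m.prod η) (fun τ p => (ψ p : ℂ) * Complex.exp (-τ * φ p)) 2 := by
  have hmL := h.measurable
  set D := |A| + |C| + 1 with hD
  have hD0 : 0 ≤ D := by positivity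
  have hα' : ∀ᵐ p ∂m.prod η, |α p.1| ≤ A := Measure.quasiMeasurePreserving_fst.ae hαA
  have hβ' : ∀ᵐ p ∂m.prod η, |β p.1| ≤ A := Measure.quasiMeasurePreserving_fst.ae hβA
  obtain ⟨hE, hEint⟩ := moderateGrowth_integral_sub (P := m.prod η) (L := fun p => ℓ p.2) (φ := φ)
    (φ₀ := fun p => α p.1 + ℓ p.2) (w := ψ) (w₀ := fun p => β p.1 + ℓ p.2) (C := D)
    (fun p => h.nonneg _)
    (fun σ hσ => by simpa using (integrable_const (1 : ℝ)).mul_prod (h.integrable_one_add_mul_exp hσ))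
    hφ (by fun_prop) (by fun_prop) (by fun_prop) hD0
    (hψβ.mono fun p hp => hp.trans (by gcongr; linarith [le_abs_self C, abs_nonneg A]))
    (hβ'.mono fun p hp => by
      have := h.nonneg p.2
      refine (abs_add_le _ _).trans ?_
      rw [abs_of_nonneg this]
      nlinarith [le_abs_self A, abs_nonneg A, abs_nonneg C])
    (hφα.mono fun p hp => hp.trans (by gcongr; linarith [le_abs_self C, abs_nonneg A]))
    (hα'.mono fun p hp => by
      rw [add_sub_cancel_right]
      linarith [le_abs_self A, abs_nonneg C])
  obtain ⟨hα1, hα2⟩ := moderateGrowth_integral_mul_exp (m := m) (A := |A| + 1) (β := fun _ => 1) hα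
    measurable_const (hαA.mono fun p hp => by linarith [le_abs_self A])
    (Eventually.of_forall fun p => by rw [abs_one]; linarith [abs_nonneg A])
  obtain ⟨hβ1, hβ2⟩ := moderateGrowth_integral_mul_exp (m := m) hα hβ hαA hβA
  simp only [Complex.ofReal_one, one_mul] at hα1 hα2
  obtain ⟨c, hc, hc1⟩ := exists_pos_integral_exp_eq hm hα hαA
  -- This is `(τ - 1)²` times the integral: the double pole comes from `ℓ`, the part from `β` has
  -- only a simple pole, and the error none. The value at `1` is again `v ∫ e^{-α}`, positive
  -- whatever the sign of `β`.
  refine ⟨fun τ => ((∫ x, Complex.exp (-τ * α x) ∂m) * v +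
      (∫ x, (β x : ℂ) * Complex.exp (-τ * α x) ∂m) * (v * τ * (τ + (-1)))) +
    ((τ + (-1)) * (τ + (-1))) * ∫ p, ((ψ p : ℂ) * Complex.exp (-τ * φ p) -
      (β p.1 + ℓ p.2 : ℝ) * Complex.exp (-τ * (α p.1 + ℓ p.2 : ℝ))) ∂m.prod η,
    ((hα1.mul (.const v)).add
      (hβ1.mul (((ModerateGrowth.const v).mul .id).mul (ModerateGrowth.id.add (.const (-1)))))).add
      (((ModerateGrowth.id.add (.const (-1))).mul (ModerateGrowth.id.add (.const (-1)))).mul hE),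
    ⟨c * v, mul_pos hc h.pos, ?_⟩, fun τ hτ => ?_⟩
  · simp only [hc1]
    push_cast
    ring
  · have hfac : ∀ p : X × E,
        ((β p.1 + ℓ p.2 : ℝ) : ℂ) * Complex.exp (-τ * (α p.1 + ℓ p.2 : ℝ)) =
        (β p.1 * Complex.exp (-τ * α p.1)) * Complex.exp (-τ * ℓ p.2) +
        Complex.exp (-τ * α p.1) * (ℓ p.2 * Complex.exp (-τ * ℓ p.2)) := fun p => by
      have : Complex.exp (-τ * (α p.1 + ℓ p.2 : ℝ)) =
        Complex.exp (-τ * α p.1) * Complex.exp (-τ * ℓ p.2) := by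
        rw [← Complex.exp_add]; push_cast; congr 1; ring
      rw [this]; push_cast; ring
    have hne : τ - 1 ≠ 0 := by rintro h0; rw [sub_eq_zero.mp h0] at hτ; simp at hτ
    have hj1 := (hβ2 τ (by linarith)).mul_prod (h.integral_exp hτ).1
    have hj2 := (hα2 τ (by linarith)).mul_prod (h.integral_mul_exp hτ).1
    have hi0 : Integrable (fun p : X × E =>
        ((β p.1 + ℓ p.2 : ℝ) : ℂ) * Complex.exp (-τ * (α p.1 + ℓ p.2 : ℝ))) (m.prod η) := by
      simp only [hfac]
      exact hj1.add hj2
    have hi1 := hEint τ (by linarith)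
    have hi : Integrable (fun p => (ψ p : ℂ) * Complex.exp (-τ * φ p)) (m.prod η) :=
      (hi1.add hi0).congr (Eventually.of_forall fun p => by simp)
    refine ⟨hi, ?_⟩
    beta_reduce
    rw [integral_sub hi hi0]
    simp only [hfac]
    rw [integral_add hj1 hj2, integral_prod_mul (fun x => (β x : ℂ) * Complex.exp (-τ * α x))
        (fun y => Complex.exp (-τ * ℓ y)), (h.integral_exp hτ).2,
      integral_prod_mul (fun x => Complex.exp (-τ * α x))
        (fun y => (ℓ y : ℂ) * Complex.exp (-τ * ℓ y)), (h.integral_mul_exp hτ).2]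
    field_simp
    ring

end Local

/-! ### Sums, products and transport of poles -/

namespace HasPoleAtOne

variable {Y : Type*} [MeasurableSpace Y] {μ : Measure Y} {N : ℕ}

theorem congr {f g : ℂ → Y → ℂ} (h : HasPoleAtOne μ f N) (hfg : ∀ τ, f τ =ᵐ[μ] g τ) :
    HasPoleAtOne μ g N := by
  obtain ⟨H, h1, h2, h3⟩ := h
  refine ⟨H, h1, h2, fun τ hτ => ⟨(h3 τ hτ).1.congr (hfg τ), ?_⟩⟩
  rw [(h3 τ hτ).2, integral_congr_ae (hfg τ)]

/-- Positivity of the leading coefficients rules out cancellation; with an empty index set the pole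
would be lost. -/
theorem sum_fun {ι : Type*} [Fintype ι] [Nonempty ι] {f : ι → ℂ → Y → ℂ}
    (h : ∀ i, HasPoleAtOne μ (f i) N) : HasPoleAtOne μ (fun τ y => ∑ i, f i τ y) N := by
  choose H h1 h2 h3 using h
  choose c hc hc1 using h2
  refine ⟨fun τ => ∑ i, H i τ, ModerateGrowth.sum _ fun i _ => h1 i,
    ⟨∑ i, c i, Finset.sum_pos (fun i _ => hc i) Finset.univ_nonempty, by simp [hc1]⟩,
    fun τ hτ => ⟨integrable_finsetSum _ fun i _ => (h3 i τ hτ).1, ?_⟩⟩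
  rw [integral_finsetSum _ fun i _ => (h3 i τ hτ).1, Finset.mul_sum]
  exact Finset.sum_congr rfl fun i _ => (h3 i τ hτ).2

theorem sum_measure {ι : Type*} [Fintype ι] [Nonempty ι] {μ : ι → Measure Y} {f : ℂ → Y → ℂ}
    (h : ∀ i, HasPoleAtOne (μ i) f N) : HasPoleAtOne (∑ i, μ i) f N := by
  choose H h1 h2 h3 using h
  choose c hc hc1 using h2
  refine ⟨fun τ => ∑ i, H i τ, ModerateGrowth.sum _ fun i _ => h1 i,
    ⟨∑ i, c i, Finset.sum_pos (fun i _ => hc i) Finset.univ_nonempty, by simp [hc1]⟩,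
    fun τ hτ => ⟨integrable_finsetSum_measure.mpr fun i _ => (h3 i τ hτ).1, ?_⟩⟩
  rw [integral_finsetSum_measure fun i _ => (h3 i τ hτ).1, Finset.mul_sum]
  exact Finset.sum_congr rfl fun i _ => (h3 i τ hτ).2

theorem smul_measure {f : ℂ → Y → ℂ} (h : HasPoleAtOne μ f N) {a : ENNReal} (h0 : a ≠ 0)
    (htop : a ≠ ⊤) : HasPoleAtOne (a • μ) f N := by
  obtain ⟨H, h1, ⟨c, hc, hc1⟩, h3⟩ := h
  refine ⟨fun τ => a.toReal * H τ, (ModerateGrowth.const _).mul h1,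
    ⟨a.toReal * c, mul_pos (ENNReal.toReal_pos h0 htop) hc, by simp [hc1]⟩,
    fun τ hτ => ⟨(h3 τ hτ).1.smul_measure htop, ?_⟩⟩
  beta_reduce
  rw [integral_smul_measure, (h3 τ hτ).2, Complex.real_smul]
  ring

theorem map {Z : Type*} [MeasurableSpace Z] {e : Y → Z} (he : MeasurableEmbedding e)
    {f : ℂ → Z → ℂ} (h : HasPoleAtOne μ (fun τ y => f τ (e y)) N) :
    HasPoleAtOne (μ.map e) f N := by
  obtain ⟨H, h1, h2, h3⟩ := h
  refine ⟨H, h1, h2, fun τ hτ => ⟨he.integrable_map_iff.mpr (h3 τ hτ).1, ?_⟩⟩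
  rw [he.integral_map, (h3 τ hτ).2]

theorem pi {ι : Type*} [Fintype ι] {E : ι → Type*} [∀ i, MeasurableSpace (E i)]
    {μ : ∀ i, Measure (E i)} [∀ i, SigmaFinite (μ i)] {f : ∀ i, ℂ → E i → ℂ} {N : ι → ℕ}
    (h : ∀ i, HasPoleAtOne (μ i) (f i) (N i)) :
    HasPoleAtOne (Measure.pi μ) (fun τ x => ∏ i, f i τ (x i)) (∑ i, N i) := by
  choose H h1 h2 h3 using h
  choose c hc hc1 using h2
  refine ⟨fun τ => ∏ i, H i τ, ModerateGrowth.prod _ fun i _ => h1 i,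
    ⟨∏ i, c i, Finset.prod_pos (fun i _ => hc i), by simp [hc1]⟩,
    fun τ hτ => ⟨Integrable.fintype_prod_dep fun i => (h3 i τ hτ).1, ?_⟩⟩
  rw [integral_fintype_prod_eq_prod (fun i => f i τ), ← Finset.prod_pow_eq_pow_sum,
    ← Finset.prod_mul_distrib]
  exact Finset.prod_congr rfl fun i _ => (h3 i τ hτ).2

/-- Products of local height integrals, weighted by a sum of local weights. -/
theorem pi_sum {ι : Type*} [Fintype ι] [Nonempty ι] {E : ι → Type*} [∀ i, MeasurableSpace (E i)]
    {μ : ∀ i, Measure (E i)} [∀ i, SigmaFinite (μ i)] {f : ∀ i, ℂ → E i → ℂ} {ψ : ∀ i, E i → ℝ}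
    (h : ∀ i, HasPoleAtOne (μ i) (f i) 1)
    (h' : ∀ i, HasPoleAtOne (μ i) (fun τ x => ψ i x * f i τ x) 2) :
    HasPoleAtOne (Measure.pi μ) (fun τ x => ((∑ i, ψ i (x i) : ℝ) : ℂ) * ∏ i, f i τ (x i))
      (Fintype.card ι + 1) := by
  classical
  have key : ∀ j : ι, HasPoleAtOne (Measure.pi μ)
      (fun τ x => (ψ j (x j) : ℂ) * ∏ i, f i τ (x i)) (Fintype.card ι + 1) := by
    intro j
    -- The weight of the place `j` makes the factor at `j` a double pole and leaves the others
    -- simple.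
    have h1 := HasPoleAtOne.pi (μ := μ) (N := fun i => if i = j then 2 else 1)
      (f := fun i τ x => (if i = j then (ψ i x : ℂ) else 1) * f i τ x) fun i => by
        by_cases hij : i = j
        · subst hij
          simpa only [if_true] using h' i
        · simpa only [hij, if_false, one_mul] using h i
    have h2 : ∑ i : ι, (if i = j then 2 else 1) = Fintype.card ι + 1 := by
      have : ∀ i : ι, (if i = j then 2 else 1) = 1 + if i = j then 1 else 0 := fun i => by
        split_ifs <;> rfl
      simp only [this, Finset.sum_add_distrib]
      simp
    rw [h2] at h1
    refine h1.congr fun τ => Eventually.of_forall fun x => ?_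
    simp only [Finset.prod_mul_distrib]
    congr 1
    rw [Finset.prod_ite_eq' Finset.univ j fun i => (ψ i (x i) : ℂ)]
    simp
  refine (sum_fun key).congr fun τ => Eventually.of_forall fun x => ?_
  simp only [← Finset.sum_mul]
  push_cast
  rfl

end HasPoleAtOne

/-! ### Norms along lines, and unipotent elements -/

/-- The growth of `‖P + y Q‖` as `y → ∞`, uniformly in a compact family. -/
theorem exists_abs_log_norm_add_smul_le {F 𝕜 V : Type*} [TopologicalSpace F] [NormedField 𝕜]
    [ProperSpace 𝕜] [NormedAddCommGroup V] [NormedSpace ℂ V] {σ : 𝕜 →+* ℂ} (hσ : Isometry σ)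
    {D : Set F} (hD : IsCompact D) {P Q : F → V} (hP : Continuous P) (hQ : Continuous Q)
    (hQ0 : ∀ x, Q x ≠ 0) (hPQ : ∀ x y, P x + σ y • Q x ≠ 0) :
    ∃ C : ℝ, 0 ≤ C ∧ ∀ x ∈ D, ∀ y : 𝕜,
      |Real.log ‖P x + σ y • Q x‖ - (Real.log ‖Q x‖ + Real.log (max 1 ‖y‖))| ≤
        C * (max 1 ‖y‖)⁻¹ := by
  have hn : ∀ y, ‖σ y‖ = ‖y‖ := fun y => by
    simpa using hσ.dist_eq y 0
  have hσc := hσ.continuous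
  obtain ⟨M₀, hM₀⟩ := hD.exists_bound_of_continuousOn (f := fun x => ‖P x‖ / ‖Q x‖)
    ((hP.norm.div hQ.norm fun x => norm_ne_zero_iff.mpr (hQ0 x)).continuousOn)
  set M := max M₀ 1 with hM
  have hM1 : 1 ≤ M := le_max_right _ _
  have hPM : ∀ x ∈ D, ‖P x‖ ≤ M * ‖Q x‖ := fun x hx => by
    have h := (hM₀ x hx).trans (le_max_left M₀ 1)
    rw [Real.norm_of_nonneg (by positivity), div_le_iff₀ (norm_pos_iff.mpr (hQ0 x))] at h
    exact h
  set G : F × 𝕜 → ℝ := fun p => Real.log ‖P p.1 + σ p.2 • Q p.1‖ -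
    (Real.log ‖Q p.1‖ + Real.log (max 1 ‖p.2‖)) with hG
  have hGc : Continuous G := by
    refine Continuous.sub (Continuous.log (by fun_prop) fun p => ?_)
      (Continuous.add (Continuous.log (by fun_prop) fun p => ?_)
        (Continuous.log (by fun_prop) fun p => ?_))
    · exact norm_ne_zero_iff.mpr (hPQ _ _)
    · exact norm_ne_zero_iff.mpr (hQ0 _)
    · exact (lt_of_lt_of_le one_pos (le_max_left _ _)).ne'
  obtain ⟨C₀, hC₀⟩ := (hD.prod (isCompact_closedBall (0 : 𝕜) (2 * M))).exists_bound_of_continuousOn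
    hGc.continuousOn
  -- The first term covers `‖y‖ ≤ 2M`, where compactness bounds the difference by `C₀`. The second
  -- covers large `y`, where `‖P + yQ‖ / (‖Q‖ ‖y‖)` differs from `1` by at most `M / ‖y‖ ≤ 1/2`, so
  -- that its logarithm is at most twice that deviation.
  refine ⟨|C₀| * (2 * M) + 2 * M, by positivity, fun x hx y => ?_⟩
  by_cases hy : ‖y‖ ≤ 2 * M
  · have h1 : |G (x, y)| ≤ |C₀| :=
      (hC₀ (x, y) ⟨hx, mem_closedBall_zero_iff.mpr hy⟩).trans (le_abs_self _)
    refine h1.trans ?_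
    have h2 : max 1 ‖y‖ ≤ 2 * M := max_le (by linarith) hy
    have h3 : 0 < max 1 ‖y‖ := lt_of_lt_of_le one_pos (le_max_left _ _)
    rw [← div_eq_mul_inv, le_div_iff₀ h3]
    nlinarith [abs_nonneg C₀]
  · push Not at hy
    have hy1 : max 1 ‖y‖ = ‖y‖ := max_eq_right (by linarith)
    have hy0 : 0 < ‖y‖ := by linarith
    have hQp : 0 < ‖Q x‖ := norm_pos_iff.mpr (hQ0 x)
    rw [hy1, ← Real.log_mul hQp.ne' hy0.ne', ← Real.log_div (norm_ne_zero_iff.mpr (hPQ x y))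
      (by positivity)]
    set t := ‖P x + σ y • Q x‖ / (‖Q x‖ * ‖y‖) with ht
    have hr : |t - 1| ≤ M * ‖y‖⁻¹ := by
      have e : t - 1 = (‖P x + σ y • Q x‖ - ‖σ y • Q x‖) / (‖Q x‖ * ‖y‖) := by
        rw [ht, norm_smul, hn]
        field_simp
      rw [e, abs_div, abs_of_pos (show 0 < ‖Q x‖ * ‖y‖ by positivity), div_le_iff₀ (by positivity)]
      calc _ ≤ ‖P x‖ := by
            simpa using abs_norm_sub_norm_le (P x + σ y • Q x) (σ y • Q x)
        _ ≤ M * ‖Q x‖ := hPM x hx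
        _ = _ := by field_simp
    have hr' : M * ‖y‖⁻¹ ≤ 1 / 2 := by
      rw [← div_eq_mul_inv, div_le_iff₀ hy0]
      linarith
    have hb := abs_le.mp hr
    have ht0 : 0 < t := by linarith
    have hlog : |Real.log t| ≤ 2 * (M * ‖y‖⁻¹) := by
      have l1 := Real.log_le_sub_one_of_pos ht0
      have l2 := Real.one_sub_inv_le_log_of_pos ht0
      refine abs_le.mpr ⟨?_, by linarith⟩
      have l3 : t⁻¹ - 1 ≤ 2 * (M * ‖y‖⁻¹) := by
        rw [inv_eq_one_div, div_sub_one ht0.ne', div_le_iff₀ ht0]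
        nlinarith
      linarith
    refine hlog.trans ?_
    have : 0 ≤ |C₀| * (2 * M) * ‖y‖⁻¹ := by positivity
    linarith

/-- The upper unipotent element with entry `z`. -/
def upperElt {R : Type*} [CommRing R] (z : R) : SpecialLinearGroup (Fin 2) R :=
  ⟨!![1, z; 0, 1], by simp [Matrix.det_fin_two]⟩

/-- The lower unipotent element with entry `x`. -/
def lowerElt {R : Type*} [CommRing R] (x : R) : SpecialLinearGroup (Fin 2) R :=
  ⟨!![1, 0; x, 1], by simp [Matrix.det_fin_two]⟩

theorem upperElt_zero {R : Type*} [CommRing R] : upperElt (0 : R) = 1 :=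
  Subtype.ext (by simp [upperElt, Matrix.one_fin_two])

theorem lowerElt_mul {R : Type*} [CommRing R] (z w : R) :
    lowerElt z * lowerElt w = lowerElt (z + w) := by
  apply Subtype.ext
  change !![1, 0; z, 1] * !![1, 0; w, 1] = !![1, 0; z + w, 1]
  simp

theorem map_upperElt {R S : Type*} [CommRing R] [CommRing S] (f : R →+* S) (z : R) :
    SpecialLinearGroup.map f (upperElt z) = upperElt (f z) := by
  refine Subtype.ext ?_
  rw [SpecialLinearGroup.map_apply_coe]
  ext i j
  fin_cases i <;> fin_cases j <;> simp [upperElt]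

theorem map_lowerElt {R S : Type*} [CommRing R] [CommRing S] (f : R →+* S) (z : R) :
    SpecialLinearGroup.map f (lowerElt z) = lowerElt (f z) := by
  refine Subtype.ext ?_
  rw [SpecialLinearGroup.map_apply_coe]
  ext i j
  fin_cases i <;> fin_cases j <;> simp [lowerElt]

theorem diagElt_mul_upperElt {R : Type*} [CommRing R] (t : Rˣ) (z : R) :
    diagElt R t * upperElt z = upperElt (t * t * z) * diagElt R t := by
  apply Subtype.ext
  change !![(t : R), 0; 0, _] * !![1, z; 0, 1] = !![1, _; 0, 1] * !![(t : R), 0; 0, _]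
  have h : (t : R) * t * z * ((t⁻¹ : Rˣ) : R) = t * z := by
    rw [mul_right_comm, mul_assoc (t : R), Units.mul_inv, mul_one]
  simp [h]

/-! ### The orbit map on unipotent elements -/

section Rep

variable {k : Type u} [Field k]

theorem evalAt_map (P : Matrix (Fin 3) (Fin 3) (MvPolynomial (Fin 2 × Fin 2) k))
    {R S : Type u} [CommRing R] [Algebra k R] [CommRing S] [Algebra k S] (f : R →ₐ[k] S)
    (g : SpecialLinearGroup (Fin 2) R) :
    evalAt P S (SpecialLinearGroup.map (f : R →+* S) g) = (evalAt P R g).map f := by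
  ext i j
  simp only [evalAt, Matrix.map_apply]
  rw [← AlgHom.comp_apply, MvPolynomial.comp_aeval]
  rfl

namespace SpinCover

variable {q : QuadraticForm k (Fin 3 → k)} (ρ : SpinCover q)

theorem act_map {R S : Type u} [CommRing R] [Algebra k R] [CommRing S] [Algebra k S]
    (f : R →ₐ[k] S) (g : SpecialLinearGroup (Fin 2) R) (x : Fin 3 → k) :
    ρ.act S (SpecialLinearGroup.map (f : R →+* S) g) x = fun i => f (ρ.act R g x i) := by
  ext i
  simp only [act, evalAt_map, mulVec, dotProduct, Matrix.map_apply, map_sum, _root_.map_mul,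
    AlgHom.commutes]

theorem act_one (R : Type u) [CommRing R] [Algebra k R] (x : Fin 3 → k) :
    ρ.act R 1 x = fun i => algebraMap k R (x i) := by
  simp [act, ρ.map_one]

theorem act_mul (R : Type u) [CommRing R] [Algebra k R] (g h : SpecialLinearGroup (Fin 2) R)
    (x : Fin 3 → k) : ρ.act R (g * h) x = evalAt ρ.poly R g *ᵥ ρ.act R h x := by
  simp [act, ρ.map_mul]

theorem evalAt_mulVec_injective (R : Type u) [CommRing R] [Algebra k R]
    (g : SpecialLinearGroup (Fin 2) R) {w : Fin 3 → R} (h : evalAt ρ.poly R g *ᵥ w = 0) :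
    w = 0 := by
  have h1 : evalAt ρ.poly R g⁻¹ *ᵥ (evalAt ρ.poly R g *ᵥ w) = w := by
    rw [Matrix.mulVec_mulVec, ← ρ.map_mul, inv_mul_cancel, ρ.map_one, Matrix.one_mulVec]
  rw [← h1, h, Matrix.mulVec_zero]

theorem act_ne_zero (F : Type u) [Field F] [Algebra k F] (g : SpecialLinearGroup (Fin 2) F)
    {x : Fin 3 → k} (hx : x ≠ 0) : ρ.act F g x ≠ 0 := by
  intro h
  apply hx
  have := ρ.evalAt_mulVec_injective F g h
  ext i
  simpa using congrFun this i

end SpinCover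

theorem dotProduct_gramMatrix_mulVec (q : QuadraticForm k (Fin 3 → k)) (x y : Fin 3 → k) :
    x ⬝ᵥ (gramMatrix q *ᵥ y) = q.polarBilin x y / 2 := by
  have hx : x = ∑ i, x i • Pi.single i (1 : k) := by
    ext j; simp [Finset.sum_apply, Pi.single_apply]
  have hy : y = ∑ i, y i • Pi.single i (1 : k) := by
    ext j; simp [Finset.sum_apply, Pi.single_apply]
  conv_rhs => rw [hx, hy]
  simp only [map_sum, LinearMap.sum_apply, map_smul, LinearMap.smul_apply, smul_eq_mul,
    QuadraticMap.polarBilin_apply_apply, dotProduct, mulVec, gramMatrix, Matrix.of_apply]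
  rw [Finset.sum_div]
  simp only [Finset.mul_sum, Finset.sum_div]
  rw [Finset.sum_comm]
  refine Finset.sum_congr rfl fun i _ => Finset.sum_congr rfl fun j _ => ?_
  ring

-- The torus fixes `x₀` and scales `n⁺(z)`, so the coefficients of the polynomial `n⁺(z) x₀` are
-- weight vectors for distinct weights, orthogonal for the form unless their weights cancel. In
-- dimension three a coefficient of degree at least two, together with `x₀` and the linear one,
-- would span the space, and the linear one would be orthogonal to everything.
open Polynomial in
theorem SpinCover.exists_act_upperElt [CharZero k] {q : QuadraticForm k (Fin 3 → k)}
    (hq : q.polarBilin.Nondegenerate) (ρ : SpinCover q) {x₀ : Fin 3 → k} (hx₀ : x₀ ≠ 0)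
    (hstab : ρ.StabilizerIsTorus x₀) :
    ∃ w : Fin 3 → k, w ≠ 0 ∧ ∀ (R : Type u) [CommRing R] [Algebra k R] (z : R),
      ρ.act R (upperElt z) x₀ = fun i => algebraMap k R (x₀ i) + z * algebraMap k R (w i) := by
  -- The generic unipotent point; naturality in the ring recovers all others by evaluation.
  set p : Fin 3 → k[X] := ρ.act k[X] (upperElt X) x₀ with hp
  have hact : ∀ (R : Type u) [CommRing R] [Algebra k R] (z : R),
      ρ.act R (upperElt z) x₀ = fun i => aeval z (p i) := by
    intro R _ _ z
    have h := ρ.act_map (aeval z : k[X] →ₐ[k] R) (upperElt X) x₀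
    rw [map_upperElt] at h
    simpa using h
  set c : ℕ → Fin 3 → k := fun j i => (p i).coeff j with hc
  have hc0 : c 0 = x₀ := by
    have h := hact k 0
    rw [upperElt_zero, ρ.act_one] at h
    ext i
    have := congrFun h i
    simp only [Algebra.algebraMap_self, RingHom.id_apply] at this
    rw [this, hc]
    simp [coeff_zero_eq_aeval_zero]
  have h2 : (2 : k) ≠ 0 := two_ne_zero
  -- In characteristic zero, `diag(2, 1/2)` alone separates the weights, because the powers of `t² =
  -- 4` are distinct.
  set t : kˣ := Units.mk0 2 h2 with ht
  set T := evalAt ρ.poly k (diagElt k t) with hT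
  have hTc : ∀ j, T *ᵥ c j = (4 : k) ^ j • c j := by
    intro j
    set t' : k[X]ˣ := Units.map (C : k →+* k[X]).toMonoidHom t with ht'
    have hmap : SpecialLinearGroup.map ((Algebra.ofId k k[X] : k →ₐ[k] k[X]) : k →+* k[X])
        (diagElt k t) = diagElt k[X] t' := by
      refine Subtype.ext ?_
      rw [SpecialLinearGroup.map_apply_coe]
      refine Matrix.ext fun i j => ?_
      fin_cases i <;> fin_cases j
      · rfl
      · exact map_zero (C : k →+* k[X])
      · exact map_zero (C : k →+* k[X])
      · rfl
    have hstab' : ρ.act k[X] (diagElt k[X] t') x₀ = fun i => algebraMap k k[X] (x₀ i) :=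
      (hstab k[X] _).mpr ⟨t', rfl⟩
    have e1 : evalAt ρ.poly k[X] (diagElt k[X] t') *ᵥ p = fun i => (p i).comp (C 4 * X) := by
      rw [hp, ← ρ.act_mul, diagElt_mul_upperElt, ρ.act_mul, hstab']
      have : (t' : k[X]) * (t' : k[X]) * X = C 4 * X := by
        change C (2 : k) * C (2 : k) * X = _
        rw [← C_mul]; norm_num
      rw [this]
      change ρ.act k[X] (upperElt (C 4 * X)) x₀ = _
      rw [hact]
      rfl
    rw [← hmap, evalAt_map] at e1
    ext i
    have e2 := congrArg (fun r : k[X] => r.coeff j) (congrFun e1 i)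
    simp only [mulVec, dotProduct, Matrix.map_apply, finsetSum_coeff, comp_C_mul_X_coeff] at e2
    simp only [mulVec, dotProduct, Pi.smul_apply, smul_eq_mul, hc]
    rw [mul_comm, ← e2]
    exact Finset.sum_congr rfl fun l _ => (coeff_C_mul _).symm
  -- Invariance multiplies the pairing by `4^{i+j} ≠ 1`.
  have hform : ∀ i j, 0 < i + j → q.polarBilin (c i) (c j) = 0 := by
    intro i j hij
    have h1 := ρ.preserves_form k (diagElt k t)
    have h3 : (T *ᵥ c i) ⬝ᵥ (gramMatrix q *ᵥ (T *ᵥ c j)) = c i ⬝ᵥ (gramMatrix q *ᵥ c j) := by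
      have h4 : (gramMatrix q).map (algebraMap k k) = gramMatrix q := by ext; simp
      rw [h4, ← hT] at h1
      rw [← Matrix.vecMul_transpose, ← Matrix.dotProduct_mulVec, Matrix.mulVec_mulVec,
        Matrix.mulVec_mulVec, h1]
    rw [hTc, hTc, dotProduct_gramMatrix_mulVec, dotProduct_gramMatrix_mulVec, map_smul, map_smul,
      LinearMap.smul_apply, smul_smul, ← pow_add, smul_eq_mul] at h3
    have h5 : ((4 : k) ^ (j + i) - 1) * q.polarBilin (c i) (c j) = 0 := by
      field_simp at h3
      linear_combination h3
    refine (mul_eq_zero.mp h5).resolve_left (sub_ne_zero.mpr fun h6 => ?_)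
    have h7 : (4 : ℕ) ^ (j + i) = 1 := by exact_mod_cast h6
    rw [Nat.pow_eq_one] at h7
    omega
  -- If the linear coefficient vanished, `n⁺(ε)` over the dual numbers would fix `x₀` without being
  -- diagonal. This uses the stabilizer as a group scheme, not only its points over fields.
  have hc1 : c 1 ≠ 0 := by
    intro h0
    have h := hact (DualNumber k) DualNumber.eps
    have h1 : ∀ r : k[X], aeval (DualNumber.eps : DualNumber k) r =
        algebraMap k _ (r.coeff 0) + DualNumber.eps * algebraMap k _ (r.coeff 1) := by
      intro r
      have e1 := divX_mul_X_add r
      have e2 := divX_mul_X_add r.divX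
      have e3 : r.divX.coeff 0 = r.coeff 1 := by simp [coeff_divX]
      rw [← e1, ← e2, e3]
      simp only [map_add, _root_.map_mul, aeval_X, aeval_C, coeff_add, coeff_C_zero, coeff_mul_X,
        mul_coeff_zero, coeff_X_zero, coeff_C_succ, mul_zero, zero_add, add_zero, add_mul]
      rw [mul_assoc, DualNumber.eps_mul_eps]
      ring
    have h2 : ρ.act (DualNumber k) (upperElt DualNumber.eps) x₀ =
        fun i => algebraMap k _ (x₀ i) := by
      rw [h]
      ext1 i
      have g0 : (p i).coeff 0 = x₀ i := congrFun hc0 i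
      have g1 : (p i).coeff 1 = 0 := congrFun h0 i
      rw [h1, g0, g1, map_zero, mul_zero, add_zero]
    obtain ⟨s, hs⟩ := (hstab _ _).mp h2
    have h3 := congrArg (fun g : SpecialLinearGroup (Fin 2) (DualNumber k) => g.1 0 1) hs
    simp only [diagElt, upperElt, Matrix.of_apply, Matrix.cons_val', Matrix.cons_val_zero,
      Matrix.cons_val_one] at h3
    have h4 := congrArg TrivSqZeroExt.snd h3
    simp at h4
  have hcj : ∀ j, 2 ≤ j → c j = 0 := by
    intro j hj
    by_contra hne
    apply hc1
    set e : Fin 3 → ℕ := ![0, 1, j] with he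
    have hinj : Function.Injective fun i => (4 : k) ^ e i := by
      have : Function.Injective e := by
        intro a b hab
        fin_cases a <;> fin_cases b <;> simp_all [e] <;> omega
      intro a b hab
      apply this
      have h1 : (4 : ℕ) ^ e a = 4 ^ e b := by
        have h2 : (4 : k) ^ e a = 4 ^ e b := hab
        exact_mod_cast h2
      exact Nat.pow_right_injective (by norm_num) h1
    -- Three eigenvectors with the distinct eigenvalues `1`, `4` and `4^j`.
    have hli := Module.End.eigenvectors_linearIndependent' (Matrix.toLin' T)
      (fun i => (4 : k) ^ e i) hinj (fun i => c (e i)) (fun i => by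
        refine ⟨Module.End.mem_eigenspace_iff.mpr (by rw [Matrix.toLin'_apply, hTc]), ?_⟩
        fin_cases i
        · simpa [e, hc0] using hx₀
        · simpa [e] using hc1
        · simpa [e] using hne)
    have hspan := hli.span_eq_top_of_card_eq_finrank (by simp)
    refine hq.1 _ fun y => ?_
    have hy : y ∈ Submodule.span k (Set.range fun i => c (e i)) := hspan ▸ Submodule.mem_top
    induction hy using Submodule.span_induction with
    | mem y hy =>
      obtain ⟨i, rfl⟩ := hy
      exact hform _ _ (by omega)
    | zero => simp
    | add y z _ _ h1 h2 => rw [map_add, h1, h2, add_zero]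
    | smul a y _ h1 => rw [map_smul, h1, smul_zero]
  refine ⟨c 1, hc1, fun R _ _ z => ?_⟩
  rw [hact]
  ext1 i
  have hpi : p i = C (x₀ i) + X * C (c 1 i) := by
    ext j
    rcases j with _ | _ | j
    · simpa using congrFun hc0 i
    · simp [hc]
    · have := congrFun (hcj (j + 2) (by omega)) i
      simpa [hc] using this
  rw [hpi, map_add, _root_.map_mul, aeval_C, aeval_C, aeval_X]

end Rep

/-! ### Norms and Haar measure at an archimedean place -/

section LocalField

variable {k : Type u} [Field k]

open InfinitePlace.Completion in
open scoped MatrixOrder in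
/-- A local norm is the pull-back of the standard Hermitian norm by an injective linear map. -/
theorem exists_localNorm_eq_norm {n : ℕ} (v : InfinitePlace k) {A : Matrix (Fin n) (Fin n) ℂ}
    (hA : A.PosDef) : ∃ T : (Fin n → ℂ) →ₗ[ℂ] EuclideanSpace ℂ (Fin n), Function.Injective T ∧
      ∀ x, localNorm v A x = ‖T fun i => extensionEmbedding v (x i)‖ := by
  obtain ⟨B, hB⟩ := CStarAlgebra.nonneg_iff_eq_star_mul_self.mp hA.posSemidef.nonneg
  refine ⟨(WithLp.linearEquiv 2 ℂ (Fin n → ℂ)).symm.toLinearMap ∘ₗ B.mulVecLin, ?_, fun x => ?_⟩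
  · refine (WithLp.linearEquiv 2 ℂ (Fin n → ℂ)).symm.injective.comp ?_
    rw [← LinearMap.ker_eq_bot, LinearMap.ker_eq_bot']
    intro z hz
    have h1 : A *ᵥ z = 0 := by
      rw [hB, ← Matrix.mulVec_mulVec, show B *ᵥ z = 0 from hz, Matrix.mulVec_zero]
    exact Matrix.mulVec_injective_iff_isUnit.mpr hA.isUnit (by rw [h1, Matrix.mulVec_zero])
  · set z : Fin n → ℂ := fun i => extensionEmbedding v (x i)
    rw [localNorm, EuclideanSpace.norm_eq]
    congr 1
    have h1 : star z ⬝ᵥ (A *ᵥ z) = star (B *ᵥ z) ⬝ᵥ (B *ᵥ z) := by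
      rw [hB, Matrix.star_eq_conjTranspose, ← Matrix.mulVec_mulVec, Matrix.dotProduct_mulVec,
        Matrix.star_mulVec]
    rw [h1, dotProduct, Complex.re_sum]
    refine Finset.sum_congr rfl fun i _ => ?_
    change (star ((B *ᵥ z) i) * (B *ᵥ z) i).re = ‖(B *ᵥ z) i‖ ^ 2
    rw [Complex.star_def, mul_comm, Complex.mul_conj, Complex.normSq_eq_norm_sq,
      Complex.ofReal_re]

instance (v : InfinitePlace k) : ProperSpace v.Completion :=
  LipschitzWith.properSpace
    (InfinitePlace.Completion.isometry_extensionEmbedding v).isClosedEmbedding.isProperMap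
    (InfinitePlace.Completion.isometry_extensionEmbedding v).lipschitz

noncomputable instance (v : InfinitePlace k) : MeasurableSpace v.Completion := borel _

instance (v : InfinitePlace k) : BorelSpace v.Completion := ⟨rfl⟩

/-- Haar measure on the completion at an infinite place. -/
noncomputable def haarAt (v : InfinitePlace k) : Measure v.Completion := Measure.addHaar

instance (v : InfinitePlace k) : (haarAt v).IsAddHaarMeasure :=
  inferInstanceAs (Measure.addHaar : Measure v.Completion).IsAddHaarMeasure

theorem addHaar_closedBall_of_isometry {E F : Type*} [NormedAddCommGroup E] [MeasurableSpace E]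
    [BorelSpace E] [NormedAddCommGroup F] [NormedSpace ℝ F] [FiniteDimensional ℝ F]
    [MeasurableSpace F] [BorelSpace F] (η : Measure E) [η.IsAddHaarMeasure] (e : E ≃+ F)
    (he : Isometry e) {r : ℝ} (hr : 0 ≤ r) :
    η (Metric.closedBall 0 r) =
      ENNReal.ofReal (r ^ Module.finrank ℝ F) * η (Metric.closedBall 0 1) := by
  have hec : Continuous e.symm := (he.right_inv e.apply_symm_apply).continuous
  set e' : E ≃ₜ+ F := { e with continuous_toFun := he.continuous, continuous_invFun := hec }
  have hH : (η.map e').IsAddHaarMeasure := e'.isAddHaarMeasure_map η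
  have hpre : ∀ s : ℝ, η.map e' (Metric.closedBall 0 s) = η (Metric.closedBall 0 s) := by
    intro s
    rw [Measure.map_apply (show Measurable e' from he.continuous.measurable)
      Metric.isClosed_closedBall.measurableSet]
    congr 1
    have := he.preimage_closedBall 0 s
    rw [map_zero] at this
    exact this
  rw [← hpre r, ← hpre 1]
  exact Measure.addHaar_closedBall' _ 0 hr

theorem haarAt_closedBall (v : InfinitePlace k) {r : ℝ} (hr : 0 ≤ r) :
    haarAt v (Metric.closedBall 0 r) =
      ENNReal.ofReal (r ^ v.mult) * haarAt v (Metric.closedBall 0 1) := by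
  by_cases hv : v.IsReal
  · have h := addHaar_closedBall_of_isometry (haarAt v)
      (InfinitePlace.Completion.ringEquivRealOfIsReal hv).toAddEquiv
      (InfinitePlace.Completion.isometry_extensionEmbeddingOfIsReal hv) hr
    rwa [Module.finrank_self, ← hv.mult_eq_one] at h
  · have hc := InfinitePlace.not_isReal_iff_isComplex.mp hv
    have h := addHaar_closedBall_of_isometry (haarAt v)
      (InfinitePlace.Completion.ringEquivComplexOfIsComplex hc).toAddEquiv
      (InfinitePlace.Completion.isometry_extensionEmbedding v) hr
    rwa [Complex.finrank_real_complex, ← hc.mult_eq_two] at h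

theorem mult_le_two (v : InfinitePlace k) : v.mult ≤ 2 := by
  unfold InfinitePlace.mult; split_ifs <;> norm_num

/-- The function `log max(1, |y|)`, normalised according to the place. -/
noncomputable def logMax (v : InfinitePlace k) (y : v.Completion) : ℝ :=
  v.mult * Real.log (max 1 ‖y‖)

/-- The sublevel set at `u ≥ 0` is the ball of radius `e^{u/mult}`, and volume scales as the radius
to the power `mult`. The cut-off at `1` makes the growth exact from `u = 0` on. -/
theorem expGrowth_logMax (v : InfinitePlace k) :
    ExpGrowth (haarAt v) (logMax v) ((haarAt v).real (Metric.closedBall 0 1)) where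
  measurable := by unfold logMax; fun_prop
  nonneg y := mul_nonneg (Nat.cast_nonneg _) (Real.log_nonneg (le_max_left _ _))
  pos := ENNReal.toReal_pos (Metric.measure_closedBall_pos _ _ one_pos).ne'
    measure_closedBall_lt_top.ne
  measure_le u hu := by
    have hd : (0 : ℝ) < v.mult := Nat.cast_pos.mpr v.mult_pos
    have hset : {y | logMax v y ≤ u} = Metric.closedBall 0 (Real.exp (u / v.mult)) := by
      ext y
      simp only [Set.mem_ofPred_eq, mem_closedBall_zero_iff, logMax]
      rw [mul_comm, ← le_div_iff₀ hd,
        Real.log_le_iff_le_exp (lt_of_lt_of_le one_pos (le_max_left _ _)), max_le_iff]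
      exact and_iff_right (Real.one_le_exp (by positivity))
    rw [hset, haarAt_closedBall v (Real.exp_nonneg _), ← Real.exp_nat_mul,
      mul_div_cancel₀ _ hd.ne', mul_comm, ENNReal.ofReal_mul measureReal_nonneg,
      ofReal_measureReal measure_closedBall_lt_top.ne]

/-- The left side is `e^{-ℓ/mult}` with `mult ≤ 2`; complex places are the extremal case. -/
theorem inv_max_le_exp_logMax (v : InfinitePlace k) (y : v.Completion) :
    (max 1 ‖y‖)⁻¹ ≤ Real.exp (-logMax v y / 2) := by
  have h0 : 0 < max 1 ‖y‖ := lt_of_lt_of_le one_pos (le_max_left _ _)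
  rw [← Real.exp_log (inv_pos.mpr h0), Real.log_inv]
  refine Real.exp_le_exp.mpr ?_
  have h1 : 0 ≤ Real.log (max 1 ‖y‖) := Real.log_nonneg (le_max_left _ _)
  have h2 : (v.mult : ℝ) ≤ 2 := by exact_mod_cast mult_le_two v
  unfold logMax
  nlinarith

/-- A family of affine lines in `k_v^n`, parametrised by `x`, that do not pass through the
origin. -/
structure LineFamily (v : InfinitePlace k) (n : ℕ)
    (P Q : v.Completion → Fin n → v.Completion) : Prop where
  continuous_left : Continuous P
  continuous_right : Continuous Q
  right_ne_zero : ∀ x, Q x ≠ 0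
  ne_zero : ∀ x y, (fun i => P x i + y * Q x i) ≠ 0

theorem localNorm_pos {n : ℕ} (v : InfinitePlace k) {A : Matrix (Fin n) (Fin n) ℂ}
    (hA : A.PosDef) {x : Fin n → v.Completion} (hx : x ≠ 0) : 0 < localNorm v A x := by
  obtain ⟨T, hT, h⟩ := exists_localNorm_eq_norm v hA
  rw [h, norm_pos_iff]
  intro h0
  apply hx
  have := hT (h0.trans (map_zero T).symm)
  ext1 i
  exact (map_eq_zero _).mp (congrFun this i)

theorem continuous_localNorm {n : ℕ} (v : InfinitePlace k) {A : Matrix (Fin n) (Fin n) ℂ} :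
    Continuous (localNorm v A) := by
  have := (InfinitePlace.Completion.isometry_extensionEmbedding v).continuous
  unfold localNorm
  refine Real.continuous_sqrt.comp (Complex.continuous_re.comp ?_)
  refine Continuous.dotProduct ?_ (continuous_const.matrix_mulVec ?_)
  · exact continuous_pi fun i => (this.comp (continuous_apply i)).star
  · exact continuous_pi fun i => this.comp (continuous_apply i)

namespace LineFamily

variable {v : InfinitePlace k} {n : ℕ} {P Q : v.Completion → Fin n → v.Completion}
  {A : Matrix (Fin n) (Fin n) ℂ}

theorem continuous_log_localNorm (h : LineFamily v n P Q) (hA : A.PosDef) :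
    Continuous fun p : v.Completion × v.Completion =>
      Real.log (localNorm v A fun i => P p.1 i + p.2 * Q p.1 i) := by
  have h1 := h.continuous_left
  have h2 := h.continuous_right
  refine Continuous.log ((continuous_localNorm v).comp (by fun_prop)) fun p => ?_
  exact (localNorm_pos v hA (h.ne_zero p.1 p.2)).ne'

theorem continuous_log_localNorm_right (h : LineFamily v n P Q) (hA : A.PosDef) :
    Continuous fun x => Real.log (localNorm v A (Q x)) :=
  Continuous.log ((continuous_localNorm v).comp h.continuous_right) fun x =>
    (localNorm_pos v hA (h.right_ne_zero x)).ne'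

open InfinitePlace.Completion in
theorem exists_abs_log_sub_le (h : LineFamily v n P Q) (hA : A.PosDef) :
    ∃ C : ℝ, 0 ≤ C ∧ ∀ x ∈ Metric.closedBall (0 : v.Completion) 1, ∀ y : v.Completion,
      |v.mult * Real.log (localNorm v A fun i => P x i + y * Q x i) -
        (v.mult * Real.log (localNorm v A (Q x)) + logMax v y)| ≤
        C * Real.exp (-logMax v y / 2) := by
  obtain ⟨T, hT, hn⟩ := exists_localNorm_eq_norm v hA
  have hT' : Continuous T := T.continuous_of_finiteDimensional
  have hσ := (isometry_extensionEmbedding v).continuous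
  have h1 := h.continuous_left
  have h2 := h.continuous_right
  have hlin : ∀ x y, T (fun i => extensionEmbedding v (P x i + y * Q x i)) =
      T (fun i => extensionEmbedding v (P x i)) +
        extensionEmbedding v y • T (fun i => extensionEmbedding v (Q x i)) := by
    intro x y
    rw [← map_smul, ← map_add]
    congr 1
    ext i
    simp
  have hne : ∀ w : Fin n → v.Completion, w ≠ 0 → T (fun i => extensionEmbedding v (w i)) ≠ 0 := by
    intro w hw h0
    have := localNorm_pos v hA hw
    rw [hn, h0, norm_zero] at this
    exact this.false
  obtain ⟨C, hC, hb⟩ := exists_abs_log_norm_add_smul_le (isometry_extensionEmbedding v)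
    (isCompact_closedBall (0 : v.Completion) 1)
    (P := fun x => T (fun i => extensionEmbedding v (P x i)))
    (Q := fun x => T (fun i => extensionEmbedding v (Q x i)))
    (by fun_prop) (by fun_prop) (fun x => hne _ (h.right_ne_zero x))
    (fun x y => by rw [← hlin]; exact hne _ (h.ne_zero x y))
  refine ⟨v.mult * C, by positivity, fun x hx y => ?_⟩
  have h3 := hb x hx y
  rw [← hlin, ← hn, ← hn] at h3
  rw [logMax, ← mul_add, ← mul_sub, abs_mul, Nat.abs_cast, mul_assoc]
  refine mul_le_mul_of_nonneg_left (h3.trans ?_) (Nat.cast_nonneg _)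
  exact mul_le_mul_of_nonneg_left (inv_max_le_exp_logMax v y) hC

theorem hasPoleAtOne (h : LineFamily v n P Q) (hA : A.PosDef) {D : Set v.Completion}
    (hD : MeasurableSet D) (hD1 : D ⊆ Metric.closedBall 0 1) (hD0 : haarAt v D ≠ 0) :
    HasPoleAtOne (((haarAt v).restrict D).prod (haarAt v))
      (fun τ p => Complex.exp (-τ * (v.mult * Real.log
        (localNorm v A fun i => P p.1 i + p.2 * Q p.1 i) : ℝ))) 1 := by
  have : IsFiniteMeasure ((haarAt v).restrict D) :=
    isFiniteMeasure_restrict.mpr (measure_ne_top_of_subset hD1 measure_closedBall_lt_top.ne)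
  have hc1 := h.continuous_log_localNorm hA
  have hc2 := h.continuous_log_localNorm_right hA
  obtain ⟨C, -, hC⟩ := h.exists_abs_log_sub_le hA
  obtain ⟨M, hM⟩ := (isCompact_closedBall (0 : v.Completion) 1).exists_bound_of_continuousOn
    (hc2.const_mul (v.mult : ℝ)).continuousOn
  have hae : ∀ᵐ x ∂(haarAt v).restrict D, x ∈ D := ae_restrict_mem hD
  refine hasPoleAtOne_exp (mt Measure.restrict_eq_zero.mp hD0) (expGrowth_logMax v)
    (α := fun x => v.mult * Real.log (localNorm v A (Q x))) (A := M) (C := C)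
    (hc1.const_mul _).measurable (hc2.const_mul _).measurable
    (hae.mono fun x hx => hM x (hD1 hx)) ?_
  filter_upwards [Measure.quasiMeasurePreserving_fst.ae hae] with p hp
  exact hC p.1 (hD1 hp) p.2

theorem hasPoleAtOne_mul {P₂ : v.Completion → Fin 2 → v.Completion}
    {Q₂ : v.Completion → Fin 2 → v.Completion} {A₂ : Matrix (Fin 2) (Fin 2) ℂ}
    (h : LineFamily v n P Q) (hA : A.PosDef) (h₂ : LineFamily v 2 P₂ Q₂) (hA₂ : A₂.PosDef)
    {D : Set v.Completion}
    (hD : MeasurableSet D) (hD1 : D ⊆ Metric.closedBall 0 1) (hD0 : haarAt v D ≠ 0) :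
    HasPoleAtOne (((haarAt v).restrict D).prod (haarAt v))
      (fun τ p => ((v.mult * (Real.log (localNorm v A₂ (Q₂ p.1)) + Real.log
          (localNorm v A₂ fun i => P₂ p.1 i + p.2 * Q₂ p.1 i)) : ℝ) : ℂ) *
        Complex.exp (-τ * (v.mult * Real.log
          (localNorm v A fun i => P p.1 i + p.2 * Q p.1 i) : ℝ))) 2 := by
  have : IsFiniteMeasure ((haarAt v).restrict D) :=
    isFiniteMeasure_restrict.mpr (measure_ne_top_of_subset hD1 measure_closedBall_lt_top.ne)
  have hc1 := h.continuous_log_localNorm hA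
  have hc2 := h.continuous_log_localNorm_right hA
  have hc3 := h₂.continuous_log_localNorm hA₂
  have hc4 := h₂.continuous_log_localNorm_right hA₂
  obtain ⟨C, hC0, hC⟩ := h.exists_abs_log_sub_le hA
  obtain ⟨C', hC0', hC'⟩ := h₂.exists_abs_log_sub_le hA₂
  obtain ⟨M, hM⟩ := (isCompact_closedBall (0 : v.Completion) 1).exists_bound_of_continuousOn
    (hc2.const_mul (v.mult : ℝ)).continuousOn
  obtain ⟨M', hM'⟩ := (isCompact_closedBall (0 : v.Completion) 1).exists_bound_of_continuousOn
    ((hc4.const_mul (v.mult : ℝ)).const_mul 2).continuousOn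
  have hae : ∀ᵐ x ∂(haarAt v).restrict D, x ∈ D := ae_restrict_mem hD
  have hae' : ∀ᵐ p ∂((haarAt v).restrict D).prod (haarAt v), p.1 ∈ D :=
    Measure.quasiMeasurePreserving_fst.ae hae
  refine hasPoleAtOne_mul_exp (mt Measure.restrict_eq_zero.mp hD0) (expGrowth_logMax v)
    (α := fun x => v.mult * Real.log (localNorm v A (Q x)))
    -- The constant column contributes `log ‖Q₂‖` once, and the asymptotics of the moving column
    -- contribute it a second time.
    (β := fun x => 2 * (v.mult * Real.log (localNorm v A₂ (Q₂ x))))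
    (A := max M M') (C := max C C')
    (hc1.const_mul _).measurable
    (((hc4.comp continuous_fst).add hc3).const_mul _).measurable
    (hc2.const_mul _).measurable ((hc4.const_mul _).const_mul _).measurable
    (hae.mono fun x hx => (hM x (hD1 hx)).trans (le_max_left _ _))
    (hae.mono fun x hx => (hM' x (hD1 hx)).trans (le_max_right _ _)) ?_ ?_
  · filter_upwards [hae'] with p hp
    exact (hC p.1 (hD1 hp) p.2).trans (by gcongr; exact le_max_left _ _)
  · filter_upwards [hae'] with p hp
    refine le_trans (le_of_eq ?_) ((hC' p.1 (hD1 hp) p.2).trans (by gcongr; exact le_max_right _ _))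
    congr 1
    ring

end LineFamily

end LocalField

/-! ### Uniqueness of the invariant measure in a chart -/

section Invariant

open Metric

/-- Invariance under partially defined maps is only expressed on compact sets, so measures have to
be identified by their values there. -/
theorem generateFrom_isCompact {A : Type*} [MetricSpace A] [ProperSpace A] [MeasurableSpace A]
    [BorelSpace A] : MeasurableSpace.generateFrom {K : Set A | IsCompact K} = ‹MeasurableSpace A› := by
  refine le_antisymm (MeasurableSpace.generateFrom_le fun K hK => IsCompact.measurableSet hK) ?_
  rw [BorelSpace.measurable_eq (α := A), borel_eq_generateFrom_isClosed]
  refine MeasurableSpace.generateFrom_le fun F hF => ?_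
  rcases isEmpty_or_nonempty A with h | ⟨⟨a⟩⟩
  · rw [Set.eq_empty_of_isEmpty F]
    exact @MeasurableSet.empty _ (MeasurableSpace.generateFrom _)
  have : F = ⋃ n : ℕ, closedBall a n ∩ F := by
    rw [← Set.iUnion_inter, iUnion_closedBall_nat, Set.univ_inter]
  rw [this]
  refine MeasurableSet.iUnion fun n => MeasurableSpace.measurableSet_generateFrom ?_
  exact (isCompact_closedBall a n).inter_right hF

theorem isPiSystem_isCompact {A : Type*} [TopologicalSpace A] [T2Space A] :
    IsPiSystem {K : Set A | IsCompact K} :=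
  fun _ hK _ hL _ => IsCompact.inter hK hL

/-- The exhaustion of a proper space by closed balls. -/
noncomputable def spanningClosedBalls {A : Type*} [MetricSpace A] [ProperSpace A]
    [MeasurableSpace A] (a : A) (μ : Measure A) [IsFiniteMeasureOnCompacts μ] :
    μ.FiniteSpanningSetsIn {K : Set A | IsCompact K} where
  set n := closedBall a n
  set_mem n := isCompact_closedBall a n
  finite n := (isCompact_closedBall a n).measure_lt_top
  spanning := iUnion_closedBall_nat a

theorem ext_of_isCompact {A : Type*} [MetricSpace A] [ProperSpace A] [MeasurableSpace A]
    [BorelSpace A] [Nonempty A] {μ ν : Measure A} [IsFiniteMeasureOnCompacts μ]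
    (h : ∀ K, IsCompact K → μ K = ν K) : μ = ν :=
  (spanningClosedBalls (Classical.arbitrary A) μ).ext generateFrom_isCompact.symm
    isPiSystem_isCompact fun K hK => h K hK

variable {A : Type*} [NormedCommRing A] [ProperSpace A] [MeasurableSpace A]
  [BorelSpace A] {α : Measure A} [α.IsAddHaarMeasure] {d : ℕ}

/-- For a fixed `t`, the measure `s ↦ ν (s × t)` is translation invariant, hence a multiple of `α`;
comparison with the unit ball eliminates the multiple. -/
theorem measure_prod_eq_of_invariant {ν : Measure (A × A)} [IsFiniteMeasureOnCompacts ν]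
    (h1 : ∀ a, ν.map (fun p => (a + p.1, p.2)) = ν) {s t : Set A} (hs : IsCompact s)
    (ht : IsCompact t) :
    ν (s ×ˢ t) * α (closedBall 0 1) = α s * ν (closedBall 0 1 ×ˢ t) := by
  set lam : Measure A := (ν.restrict (Set.univ ×ˢ t)).map Prod.fst with hlam
  have hap : ∀ S, MeasurableSet S → lam S = ν (S ×ˢ t) := by
    intro S hS
    rw [hlam, Measure.map_apply measurable_fst hS, Measure.restrict_apply (measurable_fst hS)]
    congr 1
    ext p
    simp
  have hfin : IsFiniteMeasureOnCompacts lam :=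
    ⟨fun K hK => by rw [hap K hK.measurableSet]; exact (hK.prod ht).measure_lt_top⟩
  have hinv : lam.IsAddLeftInvariant := by
    refine ⟨fun a => Measure.ext fun S hS => ?_⟩
    have hS' : MeasurableSet ((fun x => a + x) ⁻¹' S) := measurable_const_add a hS
    rw [Measure.map_apply (measurable_const_add a) hS, hap _ hS', hap S hS]
    conv_rhs => rw [← h1 a]
    rw [Measure.map_apply (by fun_prop) (hS.prod ht.measurableSet)]
    rfl
  have h := Measure.isAddLeftInvariant_eq_smul lam α
  rw [← hap s hs.measurableSet, ← hap _ isClosed_closedBall.measurableSet, h]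
  simp only [Measure.smul_apply, ENNReal.smul_def, smul_eq_mul]
  ring

/-- A measure on `A × A` that is invariant under translations of the first variable and
under the partially defined maps
`(x, y) ↦ (x / (1 + z x), (1 + z x)² y + z (1 + z x))` is a multiple of Haar measure. -/
theorem exists_eq_smul_prod_of_invariant
    (hα : ∀ r : ℝ, 0 ≤ r → α (closedBall 0 r) = ENNReal.ofReal (r ^ d) * α (closedBall 0 1))
    {ν : Measure (A × A)} [IsFiniteMeasureOnCompacts ν]
    (h1 : ∀ a, ν.map (fun p => (a + p.1, p.2)) = ν)
    (h2 : ∀ (z : A) (K K' : Set (A × A)), IsCompact K → IsCompact K' →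
      (∀ p ∈ K, IsUnit (1 + z * p.1) ∧ ∃ x' : A, x' * (1 + z * p.1) = p.1 ∧
        (x', (1 + z * p.1) ^ 2 * p.2 + z * (1 + z * p.1)) ∈ K') → ν K ≤ ν K') :
    ∃ c : ENNReal, c ≠ ⊤ ∧ ν = c • α.prod α := by
  set B : Set A := closedBall 0 1 with hB
  have hBc : IsCompact B := isCompact_closedBall _ _
  have hB0 : α B ≠ 0 := (measure_closedBall_pos α 0 one_pos).ne'
  have hBt : α B ≠ ⊤ := hBc.measure_lt_top.ne
  -- By invariance in `x`, `ν` is a product up to scaling, and `ν₀` is the factor in `y`. It remains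
  -- to prove `ν₀` translation invariant.
  set ν₀ : Measure A := (ν.restrict (B ×ˢ Set.univ)).map Prod.snd with hν₀
  have hap : ∀ S, MeasurableSet S → ν₀ S = ν (B ×ˢ S) := by
    intro S hS
    rw [hν₀, Measure.map_apply measurable_snd hS, Measure.restrict_apply (measurable_snd hS)]
    congr 1
    ext p
    simp [and_comm]
  have hfin : IsFiniteMeasureOnCompacts ν₀ :=
    ⟨fun K hK => by rw [hap K hK.measurableSet]; exact (hBc.prod hK).measure_lt_top⟩
  have hprod : ∀ s t, IsCompact s → IsCompact t → ν (s ×ˢ t) * α B = α s * ν₀ t :=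
    fun s t hs ht => by
      rw [hap t ht.measurableSet]
      exact measure_prod_eq_of_invariant h1 hs ht
  have hball : ∀ (r : ℝ) (t : Set A), 0 ≤ r → IsCompact t →
      ν (closedBall 0 r ×ˢ t) = ENNReal.ofReal (r ^ d) * ν₀ t := by
    intro r t hr ht
    have h := hprod _ t (isCompact_closedBall 0 r) ht
    rw [hα r hr, mul_right_comm] at h
    exact (ENNReal.mul_left_inj hB0 hBt).mp h
  -- As `x → 0` the partial maps tend to `y ↦ z + y`. They are applied to `E` times a ball of radius
  -- `r` in `x`, and then `r → 0`; the volumes of the `x`-balls cancel in the limit.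
  have htrans : ∀ (z : A) (E : Set A), IsCompact E → ν₀ E ≤ ν₀ ((fun y => z + y) '' E) := by
    intro z E hE
    have hEz : IsCompact ((fun y => z + y) '' E) := hE.image (by fun_prop)
    -- For `x ≠ 0` the image of `E` only lies near `z + E`, hence the thickening; compactness of `z
    -- + E` lets `δ → 0` afterwards.
    have key : ∀ δ : ℝ, 0 < δ → ν₀ E ≤ ν₀ (cthickening δ ((fun y => z + y) '' E)) := by
      intro δ hδ
      have hth : IsCompact (cthickening δ ((fun y => z + y) '' E)) := hEz.cthickening
      obtain ⟨M, hM⟩ := hE.isBounded.exists_norm_le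
      -- The `y`-coordinate misses `z + y` by `zx (2y + zxy + z)`, which has norm at most `L r` when
      -- `‖x‖ ≤ r` and `‖z‖ r < 1`.
      set L := ‖z‖ * (3 * |M| + ‖z‖) with hL
      have hL0 : 0 ≤ L := by positivity
      have hev : ∀ᶠ r : ℝ in 𝓝[>] 0,
          ν₀ E ≤ ENNReal.ofReal ((1 / (1 - ‖z‖ * r)) ^ d) *
            ν₀ (cthickening δ ((fun y => z + y) '' E)) := by
        have e1 : ∀ᶠ r : ℝ in 𝓝[>] 0, ‖z‖ * r < 1 := by
          refine (Tendsto.eventually_lt_const (v := ‖z‖ * 0) (by simp) ?_)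
          exact ((continuous_const.mul continuous_id).tendsto 0).mono_left nhdsWithin_le_nhds
        have e2 : ∀ᶠ r : ℝ in 𝓝[>] 0, L * r < δ := by
          refine (Tendsto.eventually_lt_const (v := L * 0) (by simpa using hδ) ?_)
          exact ((continuous_const.mul continuous_id).tendsto 0).mono_left nhdsWithin_le_nhds
        filter_upwards [e1, e2, self_mem_nhdsWithin] with r hr1 hr2 hr0
        have hr0' : 0 < r := hr0
        have hpos : 0 < 1 - ‖z‖ * r := by linarith
        -- The identity `x' (1 + zx) = x` bounds `‖x'‖` by `r / (1 - ‖z‖ r)`.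
        have hle := h2 z (closedBall 0 r ×ˢ E)
          (closedBall 0 (r / (1 - ‖z‖ * r)) ×ˢ cthickening δ ((fun y => z + y) '' E))
          ((isCompact_closedBall _ _).prod hE) ((isCompact_closedBall _ _).prod hth) (by
            rintro ⟨x, y⟩ ⟨hx, hy⟩
            simp only [mem_closedBall_zero_iff] at hx
            have hzx : ‖z * x‖ ≤ ‖z‖ * r :=
              (norm_mul_le _ _).trans (mul_le_mul_of_nonneg_left hx (norm_nonneg _))
            have hunit : IsUnit (1 + z * x) := by
              have := isUnit_one_sub_of_norm_lt_one (x := -(z * x))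
                (by rw [norm_neg]; linarith)
              rwa [sub_neg_eq_add] at this
            refine ⟨hunit, x * ((hunit.unit⁻¹ : Aˣ) : A), ?_, ?_, ?_⟩
            · rw [mul_assoc, IsUnit.val_inv_mul, mul_one]
            · set x' := x * ((hunit.unit⁻¹ : Aˣ) : A) with hx'
              have hxx : x' * (1 + z * x) = x := by
                rw [hx', mul_assoc, IsUnit.val_inv_mul, mul_one]
              have h3 : x' = x - x' * (z * x) := by linear_combination hxx
              have h4 : ‖x'‖ ≤ r + ‖x'‖ * (‖z‖ * r) := by
                calc ‖x'‖ = ‖x - x' * (z * x)‖ := by rw [← h3]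
                  _ ≤ ‖x‖ + ‖x' * (z * x)‖ := norm_sub_le _ _
                  _ ≤ r + ‖x'‖ * (‖z‖ * r) :=
                    add_le_add hx ((norm_mul_le _ _).trans
                      (mul_le_mul_of_nonneg_left hzx (norm_nonneg _)))
              rw [mem_closedBall_zero_iff, le_div_iff₀ hpos]
              linarith
            · refine mem_cthickening_of_dist_le _ (z + y) _ _ ⟨y, hy, rfl⟩ ?_
              have h3 : (1 + z * x) ^ 2 * y + z * (1 + z * x) - (z + y) =
                  (z * x) * (y + y + (z * x) * y + z) := by ring
              rw [dist_eq_norm, h3]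
              have hyM : ‖y‖ ≤ |M| := (hM y hy).trans (le_abs_self _)
              have h4 : ‖y + y + z * x * y + z‖ ≤ 3 * |M| + ‖z‖ := by
                have h5 : ‖z * x * y‖ ≤ |M| := by
                  refine (norm_mul_le _ _).trans ?_
                  calc _ ≤ 1 * |M| := mul_le_mul (by linarith) hyM (norm_nonneg _) zero_le_one
                    _ = _ := one_mul _
                have h6 := norm_add_le (y + y + z * x * y) z
                have h7 := norm_add_le (y + y) (z * x * y)
                have h8 := norm_add_le y y
                linarith
              calc _ ≤ ‖z * x‖ * ‖y + y + z * x * y + z‖ := norm_mul_le _ _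
                _ ≤ (‖z‖ * r) * (3 * |M| + ‖z‖) := by gcongr
                _ = L * r := by rw [hL]; ring
                _ ≤ δ := hr2.le)
        rw [hball r E hr0'.le hE, hball _ _ (by positivity) hth] at hle
        have hrd : ENNReal.ofReal (r ^ d) ≠ 0 := by
          rw [ne_eq, ENNReal.ofReal_eq_zero, not_le]; positivity
        refine (ENNReal.mul_le_mul_iff_right hrd ENNReal.ofReal_ne_top).mp (hle.trans_eq ?_)
        rw [← mul_assoc, ← ENNReal.ofReal_mul (by positivity), ← mul_pow, mul_one_div]
      have hlim : Tendsto (fun r : ℝ => ENNReal.ofReal ((1 / (1 - ‖z‖ * r)) ^ d) *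
          ν₀ (cthickening δ ((fun y => z + y) '' E))) (𝓝[>] 0)
          (𝓝 (1 * ν₀ (cthickening δ ((fun y => z + y) '' E)))) := by
        refine ENNReal.Tendsto.mul_const ?_ (Or.inr hth.measure_lt_top.ne)
        have : Tendsto (fun r : ℝ => (1 / (1 - ‖z‖ * r)) ^ d) (𝓝[>] 0) (𝓝 1) := by
          have hc : ContinuousAt (fun r : ℝ => (1 / (1 - ‖z‖ * r)) ^ d) 0 := by
            refine ContinuousAt.pow (continuousAt_const.div (by fun_prop) (by simp)) d
          have := hc.tendsto.mono_left (nhdsWithin_le_nhds (s := Set.Ioi 0))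
          simpa using this
        simpa [Function.comp_def] using (ENNReal.continuous_ofReal.tendsto 1).comp this
      rw [one_mul] at hlim
      exact ge_of_tendsto hlim hev
    have hlim := (tendsto_measure_cthickening_of_isCompact (μ := ν₀) hEz).mono_left
      (nhdsWithin_le_nhds (s := Set.Ioi 0))
    refine ge_of_tendsto hlim ?_
    filter_upwards [self_mem_nhdsWithin] with δ hδ
    exact key δ hδ
  have hinv : ν₀.IsAddLeftInvariant := by
    refine ⟨fun z => ?_⟩
    have himg : ∀ K : Set A, (fun y => z + y) ⁻¹' K = (fun y => -z + y) '' K := fun K => by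
      rw [Set.image_add_left, neg_neg]
    have hfin' : IsFiniteMeasureOnCompacts (ν₀.map fun y => z + y) := by
      refine ⟨fun K hK => ?_⟩
      rw [Measure.map_apply (measurable_const_add z) hK.measurableSet, himg]
      exact (hK.image (by fun_prop)).measure_lt_top
    refine ext_of_isCompact fun K hK => ?_
    rw [Measure.map_apply (measurable_const_add z) hK.measurableSet, himg]
    -- The inequality for `z` and the one for `-z` together give equality.
    refine le_antisymm ?_ (htrans _ K hK)
    have := htrans z _ (hK.image (f := fun y => -z + y) (by fun_prop))
    rwa [← Set.image_comp, show (fun y => z + y) ∘ (fun y => -z + y) = id by ext; simp,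
      Set.image_id] at this
  have hc := Measure.isAddLeftInvariant_eq_smul ν₀ α
  set c := ν₀.addHaarScalarFactor α
  refine ⟨c / α B, ENNReal.div_ne_top ENNReal.coe_ne_top hB0, ?_⟩
  have hdiv : (c : ENNReal) / α B ≠ ⊤ := ENNReal.div_ne_top ENNReal.coe_ne_top hB0
  have hfin'' : IsFiniteMeasureOnCompacts (((c : ENNReal) / α B) • α) :=
    ⟨fun K hK => by
      rw [Measure.smul_apply, smul_eq_mul]
      exact ENNReal.mul_lt_top hdiv.lt_top hK.measure_lt_top⟩
  rw [← Measure.prod_smul_right]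
  refine (Measure.prod_eq_generateFrom generateFrom_isCompact generateFrom_isCompact
    isPiSystem_isCompact isPiSystem_isCompact (spanningClosedBalls 0 α)
    (spanningClosedBalls 0 _) fun s hs t ht => ?_).symm
  have h := hprod s t hs ht
  rw [hc, Measure.smul_apply, ENNReal.smul_def, smul_eq_mul] at h
  rw [Measure.smul_apply, smul_eq_mul, ← ENNReal.mul_left_inj hB0 hBt, h, mul_assoc,
    mul_right_comm, ENNReal.div_mul_cancel hB0 hBt]

end Invariant

/-! ### Matrix identities in `SL₂` -/

section Elements

variable {R : Type*} [CommRing R]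

/-- The element of `SL₂(R)` equal to the identity where the idempotent `e` is `0`, and to the
Weyl element where `e` is `1`. -/
def switchElt (e : R) (he : e * e = e) : SpecialLinearGroup (Fin 2) R :=
  ⟨!![1 - e, e; -e, 1 - e], by rw [Matrix.det_fin_two_of]; linear_combination 2 * he⟩

theorem map_switchElt {S : Type*} [CommRing S] (f : R →+* S) (e : R) (he : e * e = e) :
    SpecialLinearGroup.map f (switchElt e he) =
      switchElt (f e) (by rw [← map_mul, he]) := by
  refine Subtype.ext ?_
  rw [SpecialLinearGroup.map_apply_coe]
  ext i j
  fin_cases i <;> fin_cases j <;> simp [switchElt]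

/-- Left translation by `n⁺(z)` read in the chart: it is defined where `1 + zx` is a unit, and the
diagonal factor disappears in the quotient. -/
theorem upperElt_mul_lowerElt_mul_upperElt (z x y x' : R) (t : Rˣ) (ht : (t : R) = 1 + z * x)
    (hx' : x' * t = x) :
    upperElt z * (lowerElt x * upperElt y) =
      lowerElt x' * upperElt ((1 + z * x) ^ 2 * y + z * (1 + z * x)) * diagElt R t := by
  apply Subtype.ext
  change !![1, z; 0, 1] * (!![1, 0; x, 1] * !![1, y; 0, 1]) =
    !![1, 0; x', 1] * !![1, (1 + z * x) ^ 2 * y + z * (1 + z * x); 0, 1] *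
      !![(t : R), 0; 0, ((t⁻¹ : Rˣ) : R)]
  rw [← ht]
  have hti : (t : R) * ((t⁻¹ : Rˣ) : R) = 1 := t.mul_inv
  ext i j
  fin_cases i <;> fin_cases j <;> simp [Matrix.mul_apply, Fin.sum_univ_two]
  · linear_combination -ht
  · linear_combination -(z + t * y) * hti - y * ht
  · exact hx'.symm
  · linear_combination (-x' * (t * y + z)) * hti - y * hx' + ((t⁻¹ : Rˣ) : R) * ht -
      z * ((t⁻¹ : Rˣ) : R) * hx' - (1 - x' * z) * hti

end Elements

/-! ### The chart of `SL₂ / H` -/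

section Chart

variable {R : Type*} [CommRing R]

/-- The chart `(x, y) ↦ n⁻(x) n⁺(y) H` of `SL₂(R) / H`. -/
noncomputable def chart (p : R × R) : SpecialLinearGroup (Fin 2) R ⧸ diagTorus R :=
  QuotientGroup.mk (lowerElt p.1 * upperElt p.2)

theorem mk_eq_mk_iff {g h : SpecialLinearGroup (Fin 2) R} :
    (QuotientGroup.mk g : SpecialLinearGroup (Fin 2) R ⧸ diagTorus R) = QuotientGroup.mk h ↔
      ∃ t : Rˣ, h = g * diagElt R t := by
  rw [QuotientGroup.eq]
  constructor
  · rintro ⟨t, ht⟩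
    exact ⟨t, by rw [ht]; group⟩
  · rintro ⟨t, rfl⟩
    exact ⟨t, by group⟩

theorem lowerElt_mul_upperElt_coe (x y : R) :
    (lowerElt x * upperElt y).1 = !![1, y; x, x * y + 1] := by
  change !![1, 0; x, 1] * !![1, y; 0, 1] = _
  simp

theorem mul_diagElt_coe (g : SpecialLinearGroup (Fin 2) R) (t : Rˣ) :
    (g * diagElt R t).1 = !![g.1 0 0 * t, g.1 0 1 * ((t⁻¹ : Rˣ) : R);
      g.1 1 0 * t, g.1 1 1 * ((t⁻¹ : Rˣ) : R)] := by
  change g.1 * !![(t : R), 0; 0, ((t⁻¹ : Rˣ) : R)] = _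
  ext i j
  fin_cases i <;> fin_cases j <;> simp [Matrix.mul_apply, Fin.sum_univ_two]

/-- Both representatives have upper left entry `1`, which forces the torus element relating them to
be trivial. -/
theorem chart_injective : Function.Injective (chart (R := R)) := by
  rintro ⟨x, y⟩ ⟨x', y'⟩ h
  obtain ⟨t, ht⟩ := mk_eq_mk_iff.mp h
  have h1 := congrArg Subtype.val ht
  rw [mul_diagElt_coe, lowerElt_mul_upperElt_coe, lowerElt_mul_upperElt_coe] at h1
  have h00 : (1 : R) = 1 * t := congrFun (congrFun h1 0) 0
  have h01 : y' = y * ((t⁻¹ : Rˣ) : R) := congrFun (congrFun h1 0) 1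
  have h10 : x' = x * t := congrFun (congrFun h1 1) 0
  have ht1 : t = 1 := Units.ext (by rw [one_mul] at h00; exact h00.symm)
  subst ht1
  simp at h01 h10
  rw [h01, h10]

/-- The entries `ad`, `ab`, `cd` and `bc`, which determine the coset of a matrix modulo the
diagonal torus. -/
def cosetEntries : SpecialLinearGroup (Fin 2) R ⧸ diagTorus R → R × R × R × R :=
  Quotient.lift (fun g : SpecialLinearGroup (Fin 2) R =>
    (g.1 0 0 * g.1 1 1, g.1 0 0 * g.1 0 1, g.1 1 0 * g.1 1 1, g.1 0 1 * g.1 1 0)) (by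
    intro g h hgh
    obtain ⟨t, rfl⟩ := mk_eq_mk_iff.mp (Quotient.sound hgh)
    have ht : (t : R) * ((t⁻¹ : Rˣ) : R) = 1 := t.mul_inv
    simp only [mul_diagElt_coe, Matrix.of_apply, Matrix.cons_val', Matrix.cons_val_zero,
      Matrix.cons_val_one, Prod.mk.injEq, Matrix.cons_val_fin_one]
    refine ⟨?_, ?_, ?_, ?_⟩
    · linear_combination (-(g.1 0 0 * g.1 1 1)) * ht
    · linear_combination (-(g.1 0 0 * g.1 0 1)) * ht
    · linear_combination (-(g.1 1 0 * g.1 1 1)) * ht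
    · linear_combination (-(g.1 0 1 * g.1 1 0)) * ht)

/-- Up to signs these are the entries of `g E₁₁ g⁻¹`, the projection onto the line of `g e₁` along
that of `g e₂`. -/
theorem cosetEntries_injective : Function.Injective (cosetEntries (R := R)) := by
  intro p p' h
  induction p using QuotientGroup.induction_on with | H g => ?_
  induction p' using QuotientGroup.induction_on with | H g' => ?_
  obtain ⟨h1, h2, h3, h4⟩ : g.1 0 0 * g.1 1 1 = g'.1 0 0 * g'.1 1 1 ∧
      g.1 0 0 * g.1 0 1 = g'.1 0 0 * g'.1 0 1 ∧ g.1 1 0 * g.1 1 1 = g'.1 1 0 * g'.1 1 1 ∧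
      g.1 0 1 * g.1 1 0 = g'.1 0 1 * g'.1 1 0 := by
    simpa [cosetEntries] using h
  have hd : g.1 0 0 * g.1 1 1 - g.1 0 1 * g.1 1 0 = 1 := by
    rw [← Matrix.det_fin_two]; exact g.2
  have hd' : g'.1 0 0 * g'.1 1 1 - g'.1 0 1 * g'.1 1 0 = 1 := by
    rw [← Matrix.det_fin_two]; exact g'.2
  rw [mk_eq_mk_iff]
  set a := g.1 0 0
  set b := g.1 0 1
  set c := g.1 1 0
  set d := g.1 1 1
  set a' := g'.1 0 0
  set b' := g'.1 0 1
  set c' := g'.1 1 0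
  set d' := g'.1 1 1
  -- The unit and its inverse are the diagonal entries of `g⁻¹ g'`.
  refine ⟨⟨d * a' - b * c', a * d' - c * b', ?_, ?_⟩, ?_⟩
  · linear_combination a' * d' * h1 - a' * b' * h3 - c' * d' * h2 + b' * c' * h4 +
      (a' * d' - b' * c' + 1) * hd'
  · linear_combination a' * d' * h1 - a' * b' * h3 - c' * d' * h2 + b' * c' * h4 +
      (a' * d' - b' * c' + 1) * hd'
  · apply Subtype.ext
    rw [mul_diagElt_coe]
    ext i j
    fin_cases i <;> fin_cases j
    · change a' = a * (d * a' - b * c')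
      linear_combination -a' * h1 + c' * h2 - a' * hd'
    · change b' = b * (a * d' - c * b')
      linear_combination -d' * h2 + b' * h4 - b' * hd'
    · change c' = c * (d * a' - b * c')
      linear_combination -a' * h3 + c' * h4 - c' * hd'
    · change d' = d * (a * d' - c * b')
      linear_combination -d' * h1 + b' * h3 - d' * hd'

theorem lowerElt_smul_chart (a : R) (p : R × R) :
    lowerElt a • chart p = chart (a + p.1, p.2) := by
  change QuotientGroup.mk (lowerElt a * (lowerElt p.1 * upperElt p.2)) = _
  rw [← mul_assoc, lowerElt_mul]
  rfl

theorem lowerElt_zero : lowerElt (0 : R) = 1 :=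
  Subtype.ext (by simp [lowerElt, Matrix.one_fin_two])

/-- The coset of a matrix with invertible upper left entry is in the image of the chart. -/
theorem eq_lowerElt_mul_upperElt_mul_diagElt (g : SpecialLinearGroup (Fin 2) R) (t : Rˣ)
    (ht : (t : R) = g.1 0 0) :
    g = lowerElt (g.1 1 0 * ((t⁻¹ : Rˣ) : R)) * upperElt (g.1 0 1 * t) * diagElt R t := by
  have hti : (t : R) * ((t⁻¹ : Rˣ) : R) = 1 := t.mul_inv
  have hd : (t : R) * g.1 1 1 - g.1 0 1 * g.1 1 0 = 1 := by
    rw [ht, ← Matrix.det_fin_two]; exact g.2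
  apply Subtype.ext
  rw [mul_diagElt_coe, lowerElt_mul_upperElt_coe]
  ext i j
  fin_cases i <;> fin_cases j
  · change g.1 0 0 = 1 * t
    rw [ht, one_mul]
  · change g.1 0 1 = g.1 0 1 * t * ((t⁻¹ : Rˣ) : R)
    linear_combination -g.1 0 1 * hti
  · change g.1 1 0 = g.1 1 0 * ((t⁻¹ : Rˣ) : R) * t
    linear_combination -g.1 1 0 * hti
  · change g.1 1 1 = (g.1 1 0 * ((t⁻¹ : Rˣ) : R) * (g.1 0 1 * t) + 1) * ((t⁻¹ : Rˣ) : R)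
    linear_combination (-g.1 1 1 - g.1 1 0 * g.1 0 1 * ((t⁻¹ : Rˣ) : R)) * hti +
      ((t⁻¹ : Rˣ) : R) * hd

variable [TopologicalSpace R]

theorem continuous_lowerElt : Continuous (lowerElt : R → SpecialLinearGroup (Fin 2) R) := by
  refine Continuous.subtype_mk ?_ _
  refine continuous_matrix fun i j => ?_
  fin_cases i <;> fin_cases j <;> simp <;> fun_prop

theorem continuous_upperElt : Continuous (upperElt : R → SpecialLinearGroup (Fin 2) R) := by
  refine Continuous.subtype_mk ?_ _
  refine continuous_matrix fun i j => ?_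
  fin_cases i <;> fin_cases j <;> simp <;> fun_prop

variable [IsTopologicalRing R]

theorem continuous_chart : Continuous (chart (R := R)) :=
  QuotientGroup.continuous_mk.comp
    ((continuous_lowerElt.comp continuous_fst).mul (continuous_upperElt.comp continuous_snd))

theorem continuous_cosetEntries : Continuous (cosetEntries (R := R)) := by
  refine Continuous.quotient_lift ?_ _
  have h : ∀ i j, Continuous fun g : SpecialLinearGroup (Fin 2) R => g.1 i j := fun i j =>
    continuous_subtype_val.matrix_elem i j
  exact ((h _ _).mul (h _ _)).prodMk (((h _ _).mul (h _ _)).prodMk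
    (((h _ _).mul (h _ _)).prodMk ((h _ _).mul (h _ _))))

/-- The Hausdorff property is needed for continuous injective charts to be measurable embeddings. -/
instance [T2Space R] : T2Space (SpecialLinearGroup (Fin 2) R ⧸ diagTorus R) :=
  T2Space.of_injective_continuous cosetEntries_injective continuous_cosetEntries

end Chart

section ChartMeasure

variable {A : Type*} [NormedCommRing A] [ProperSpace A] [MeasurableSpace A] [BorelSpace A]
  [MeasurableSpace (SpecialLinearGroup (Fin 2) A ⧸ diagTorus A)]
  [BorelSpace (SpecialLinearGroup (Fin 2) A ⧸ diagTorus A)]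

theorem measurableEmbedding_chart : MeasurableEmbedding (chart (R := A)) :=
  continuous_chart.measurableEmbedding chart_injective

/-- Lower unipotent elements translate `x`, and upper ones act by the partial maps; these two
families already pin down the measure. -/
theorem exists_comap_chart_eq {α : Measure A} [α.IsAddHaarMeasure] {d : ℕ}
    (hα : ∀ r : ℝ, 0 ≤ r →
      α (Metric.closedBall 0 r) = ENNReal.ofReal (r ^ d) * α (Metric.closedBall 0 1))
    (μ : Measure (SpecialLinearGroup (Fin 2) A ⧸ diagTorus A)) [IsFiniteMeasureOnCompacts μ]
    [SMulInvariantMeasure (SpecialLinearGroup (Fin 2) A) _ μ] :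
    ∃ c : ENNReal, c ≠ ⊤ ∧ μ.comap chart = c • α.prod α := by
  have hfin : IsFiniteMeasureOnCompacts (μ.comap (chart (R := A))) :=
    IsFiniteMeasureOnCompacts.comap' μ continuous_chart measurableEmbedding_chart
  refine exists_eq_smul_prod_of_invariant hα (fun a => ?_) (fun z K K' hK hK' h => ?_)
  · refine Measure.ext fun S hS => ?_
    rw [Measure.map_apply (by fun_prop) hS, measurableEmbedding_chart.comap_apply,
      measurableEmbedding_chart.comap_apply, ← measure_preimage_smul μ (lowerElt a) (chart '' S)]
    congr 1
    ext y
    constructor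
    · rintro ⟨p, hp, rfl⟩
      exact ⟨_, hp, (lowerElt_smul_chart a p).symm⟩
    · rintro ⟨p, hp, hy⟩
      refine ⟨(-a + p.1, p.2), by simpa using hp, ?_⟩
      rw [← lowerElt_smul_chart, hy]
      beta_reduce
      rw [smul_smul, lowerElt_mul, neg_add_cancel, lowerElt_zero, one_smul]
  · rw [measurableEmbedding_chart.comap_apply, measurableEmbedding_chart.comap_apply,
      ← measure_preimage_smul μ (upperElt z) (chart '' K')]
    refine measure_mono ?_
    rintro _ ⟨p, hp, rfl⟩
    obtain ⟨⟨t, ht⟩, x', hx', hmem⟩ := h p hp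
    refine ⟨_, hmem, ?_⟩
    refine mk_eq_mk_iff.mpr ⟨t, ?_⟩
    exact upperElt_mul_lowerElt_mul_upperElt z p.1 p.2 x' t ht (by rw [ht, hx'])

end ChartMeasure

/-! ### Charts over a product of fields and the partition of the quotient -/

section PiChart

variable {ι : Type*} {K : ι → Type*} [∀ i, NormedField (K i)]

/-- The chart of `SL₂(∏ K_i) / H` in coordinates `(x_i, y_i)`, translated by `w`. -/
noncomputable def piChart (w : SpecialLinearGroup (Fin 2) (∀ i, K i)) (p : ∀ i, K i × K i) :
    SpecialLinearGroup (Fin 2) (∀ i, K i) ⧸ diagTorus (∀ i, K i) :=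
  QuotientGroup.mk (w * (lowerElt (fun i => (p i).1) * upperElt fun i => (p i).2))

theorem piChart_eq (w : SpecialLinearGroup (Fin 2) (∀ i, K i)) (p : ∀ i, K i × K i) :
    piChart w p = w • chart (fun i => (p i).1, fun i => (p i).2) := rfl

theorem piChart_injective (w : SpecialLinearGroup (Fin 2) (∀ i, K i)) :
    Function.Injective (piChart w) := by
  intro p p' h
  rw [piChart_eq, piChart_eq, smul_left_cancel_iff] at h
  have h1 := Prod.mk.inj (chart_injective h)
  exact funext fun i => Prod.ext (congrFun h1.1 i) (congrFun h1.2 i)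

theorem continuous_piChart (w : SpecialLinearGroup (Fin 2) (∀ i, K i)) :
    Continuous (piChart w) := by
  have h : Continuous fun p : ∀ i, K i × K i => chart (fun i => (p i).1, fun i => (p i).2) :=
    continuous_chart.comp (by fun_prop)
  exact h.const_smul w

/-- The indicator of a set of factors, as an idempotent of the product ring. -/
def indic (K : ι → Type*) [∀ i, NormedField (K i)] (S : ι → Bool) : ∀ i, K i :=
  fun i => if S i then 1 else 0

theorem indic_mul_self (S : ι → Bool) : indic K S * indic K S = indic K S := by
  ext i; simp only [indic, Pi.mul_apply]; split_ifs <;> simp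

/-- The Weyl element in the factors belonging to `S`, the identity in the others. -/
def piSwitch (K : ι → Type*) [∀ i, NormedField (K i)] (S : ι → Bool) :
    SpecialLinearGroup (Fin 2) (∀ i, K i) :=
  switchElt (indic K S) (indic_mul_self S)

/-- The unit ball, open or closed according to the value of the boolean. -/
def unitBall (F : Type*) [NormedField F] (b : Bool) : Set F :=
  if b then Metric.ball 0 1 else Metric.closedBall 0 1

theorem div_mem_unitBall {F : Type*} [NormedField F] (b : Bool) {a c : F} (ha : a ≠ 0) :
    c * a⁻¹ ∈ unitBall F b ↔ (if b then ‖c‖ < ‖a‖ else ‖c‖ ≤ ‖a‖) := by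
  have h : 0 < ‖a‖ := norm_pos_iff.mpr ha
  cases b
  · simp [unitBall, ← div_eq_mul_inv, div_le_one h]
  · simp [unitBall, ← div_eq_mul_inv, div_lt_one h]

theorem norm_piSwitch_mul (S : ι → Bool) (g : SpecialLinearGroup (Fin 2) (∀ i, K i)) (i : ι) :
    (S i = true ↔ ‖(piSwitch K S * g).1 0 0 i‖ < ‖(piSwitch K S * g).1 1 0 i‖) ↔
      (if S i then ‖g.1 1 0 i‖ < ‖g.1 0 0 i‖ else ‖g.1 1 0 i‖ ≤ ‖g.1 0 0 i‖) := by
  have h0 : (piSwitch K S * g).1 0 0 i =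
      (1 - indic K S i) * g.1 0 0 i + indic K S i * g.1 1 0 i := by
    change (!![1 - indic K S, indic K S; -indic K S, 1 - indic K S] * g.1) 0 0 i = _
    simp [Matrix.mul_apply, Fin.sum_univ_two]
  have h1 : (piSwitch K S * g).1 1 0 i =
      -indic K S i * g.1 0 0 i + (1 - indic K S i) * g.1 1 0 i := by
    change (!![1 - indic K S, indic K S; -indic K S, 1 - indic K S] * g.1) 1 0 i = _
    simp [Matrix.mul_apply, Fin.sum_univ_two]
  rw [h0, h1]
  cases h : S i <;> simp [indic, h]

/-- The coordinate `x_i` is the ratio of the entries of the first column, after the swap at the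
places of `S`. Taking the open disc in the swapped factors and the closed one in the others
partitions each projective line exactly, so every coset belongs to a single `S`. -/
theorem mk_mem_image_piChart (S : ι → Bool) (g : SpecialLinearGroup (Fin 2) (∀ i, K i)) :
    (QuotientGroup.mk g : SpecialLinearGroup (Fin 2) (∀ i, K i) ⧸ diagTorus (∀ i, K i)) ∈
        piChart (piSwitch K S) '' (Set.univ.pi fun i => unitBall (K i) (S i) ×ˢ Set.univ) ↔
      ∀ i, S i = true ↔ ‖g.1 0 0 i‖ < ‖g.1 1 0 i‖ := by
  constructor
  · rintro ⟨p, hp, hpg⟩ i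
    obtain ⟨t, rfl⟩ := mk_eq_mk_iff.mp hpg
    have hti : (t : ∀ i, K i) i ≠ 0 := by
      intro h0
      have h1 := congrFun t.mul_inv i
      rw [Pi.mul_apply, h0, zero_mul] at h1
      exact zero_ne_one h1
    rw [mul_assoc, norm_piSwitch_mul, ← div_mem_unitBall (S i), mul_diagElt_coe,
      lowerElt_mul_upperElt_coe]
    · have h2 := (hp i trivial).1
      simpa [hti] using h2
    · rw [mul_diagElt_coe, lowerElt_mul_upperElt_coe]
      simpa using hti
  · intro h
    set w := piSwitch K S
    set g' := w⁻¹ * g with hg'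
    have hg : g = w * g' := by rw [hg', mul_inv_cancel_left]
    have h' : ∀ i, if S i then ‖g'.1 1 0 i‖ < ‖g'.1 0 0 i‖ else ‖g'.1 1 0 i‖ ≤ ‖g'.1 0 0 i‖ :=
      fun i => (norm_piSwitch_mul S g' i).mp (by rw [← hg]; exact h i)
    have ha : ∀ i, g'.1 0 0 i ≠ 0 := by
      intro i h0
      have hd : g'.1 0 0 * g'.1 1 1 - g'.1 0 1 * g'.1 1 0 = 1 := by
        rw [← Matrix.det_fin_two]; exact g'.2
      have hi := congrFun hd i
      have h1 := h' i
      rw [h0, norm_zero] at h1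
      have h2 : g'.1 1 0 i = 0 := by
        split_ifs at h1
        · exact absurd h1 (norm_nonneg _).not_gt
        · exact norm_le_zero_iff.mp h1
      simp [h0, h2] at hi
    set t : (∀ i, K i)ˣ := ⟨g'.1 0 0, fun i => (g'.1 0 0 i)⁻¹,
      funext fun i => mul_inv_cancel₀ (ha i), funext fun i => inv_mul_cancel₀ (ha i)⟩ with ht
    refine ⟨fun i => (g'.1 1 0 i * (g'.1 0 0 i)⁻¹, g'.1 0 1 i * g'.1 0 0 i), fun i _ => ?_, ?_⟩
    · exact ⟨(div_mem_unitBall _ (ha i)).mpr (h' i), trivial⟩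
    · refine mk_eq_mk_iff.mpr ⟨t, ?_⟩
      rw [mul_assoc, hg]
      congr 1
      exact eq_lowerElt_mul_upperElt_mul_diagElt g' t rfl

variable [Fintype ι] [∀ i, ProperSpace (K i)] [∀ i, MeasurableSpace (K i)]

theorem pi_closedBall (h : ∀ i, Measure (K i)) [∀ i, (h i).IsAddHaarMeasure] (d : ι → ℕ)
    (hd : ∀ i (r : ℝ), 0 ≤ r → h i (Metric.closedBall 0 r) =
      ENNReal.ofReal (r ^ d i) * h i (Metric.closedBall 0 1)) (r : ℝ) (hr : 0 ≤ r) :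
    Measure.pi h (Metric.closedBall 0 r) =
      ENNReal.ofReal (r ^ ∑ i, d i) * Measure.pi h (Metric.closedBall 0 1) := by
  rw [closedBall_pi _ hr, closedBall_pi _ zero_le_one, Measure.pi_pi, Measure.pi_pi,
    ← Finset.prod_pow_eq_pow_sum, ENNReal.ofReal_prod_of_nonneg fun i _ => pow_nonneg hr _,
    ← Finset.prod_mul_distrib]
  exact Finset.prod_congr rfl fun i _ => hd i r hr

variable [∀ i, BorelSpace (K i)]
  [MeasurableSpace (SpecialLinearGroup (Fin 2) (∀ i, K i) ⧸ diagTorus (∀ i, K i))]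
  [BorelSpace (SpecialLinearGroup (Fin 2) (∀ i, K i) ⧸ diagTorus (∀ i, K i))]

theorem measurableEmbedding_piChart (w : SpecialLinearGroup (Fin 2) (∀ i, K i)) :
    MeasurableEmbedding (piChart w) :=
  (continuous_piChart w).measurableEmbedding (piChart_injective w)

theorem exists_restrict_range_piChart (h : ∀ i, Measure (K i)) [∀ i, (h i).IsAddHaarMeasure]
    (d : ι → ℕ) (hd : ∀ i (r : ℝ), 0 ≤ r → h i (Metric.closedBall 0 r) =
      ENNReal.ofReal (r ^ d i) * h i (Metric.closedBall 0 1))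
    (μ : Measure (SpecialLinearGroup (Fin 2) (∀ i, K i) ⧸ diagTorus (∀ i, K i)))
    [IsFiniteMeasureOnCompacts μ]
    [SMulInvariantMeasure (SpecialLinearGroup (Fin 2) (∀ i, K i)) _ μ] :
    ∃ c : ENNReal, c ≠ ⊤ ∧ μ.restrict (Set.range (piChart 1)) =
      c • (Measure.pi fun i => (h i).prod (h i)).map (piChart 1) := by
  obtain ⟨c, hc, hμ⟩ := exists_comap_chart_eq (pi_closedBall h d hd) μ
  set e : ((∀ i, K i) × (∀ i, K i)) ≃ₜ+ (∀ i, K i × K i) :=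
    { toFun := fun p i => (p.1 i, p.2 i)
      invFun := fun p => (fun i => (p i).1, fun i => (p i).2)
      left_inv := fun _ => rfl
      right_inv := fun _ => rfl
      map_add' := fun _ _ => rfl
      continuous_toFun := by fun_prop
      continuous_invFun := by fun_prop }
  have he : Measurable e := e.continuous.measurable
  have hchart : chart = piChart 1 ∘ e := by
    ext p
    change _ = QuotientGroup.mk (1 * _)
    rw [one_mul]
    rfl
  have h1 : ((Measure.pi h).prod (Measure.pi h)).IsAddHaarMeasure :=
    Measure.prod.instIsAddHaarMeasure _ _
  have h2 : ∀ i, ((h i).prod (h i)).IsAddHaarMeasure := fun i =>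
    Measure.prod.instIsAddHaarMeasure _ _
  have h3 : (Measure.pi fun i => (h i).prod (h i)).IsAddHaarMeasure :=
    Measure.pi.isAddHaarMeasure _
  have hH := e.isAddHaarMeasure_map ((Measure.pi h).prod (Measure.pi h))
  -- Regrouping the coordinates preserves Haar measure up to a scalar, which need not be computed.
  have hu := Measure.isAddLeftInvariant_eq_smul
    (((Measure.pi h).prod (Measure.pi h)).map e) (Measure.pi fun i => (h i).prod (h i))
  set c' := Measure.addHaarScalarFactor (((Measure.pi h).prod (Measure.pi h)).map e)
    (Measure.pi fun i => (h i).prod (h i))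
  refine ⟨c * c', ENNReal.mul_ne_top hc ENNReal.coe_ne_top, ?_⟩
  have hr : Set.range (piChart (K := K) 1) = Set.range chart := by
    rw [hchart, Set.range_comp, e.surjective.range_eq, Set.image_univ]
  rw [hr, ← measurableEmbedding_chart.map_comap, hμ, Measure.map_smul, hchart,
    ← Measure.map_map (measurableEmbedding_piChart 1).measurable he, hu, mul_smul]
  congr 1
  exact Measure.map_smul _ _ _

/-- An invariant measure on `SL₂(∏ K_i) / H` in coordinates: the homogeneous space is the disjoint
union of the images of finitely many charts, on which the measure is a product of Haar measures. -/
theorem exists_eq_smul_sum_map_piChart (h : ∀ i, Measure (K i)) [∀ i, (h i).IsAddHaarMeasure]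
    (d : ι → ℕ) (hd : ∀ i (r : ℝ), 0 ≤ r → h i (Metric.closedBall 0 r) =
      ENNReal.ofReal (r ^ d i) * h i (Metric.closedBall 0 1))
    (μ : Measure (SpecialLinearGroup (Fin 2) (∀ i, K i) ⧸ diagTorus (∀ i, K i)))
    [IsFiniteMeasureOnCompacts μ]
    [SMulInvariantMeasure (SpecialLinearGroup (Fin 2) (∀ i, K i)) _ μ] [DecidableEq ι] :
    ∃ c : ENNReal, c ≠ ⊤ ∧ μ = c • ∑ S : ι → Bool,
      (Measure.pi fun i => ((h i).restrict (unitBall (K i) (S i))).prod (h i)).map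
        (piChart (piSwitch K S)) := by
  obtain ⟨c, hc, hμ⟩ := exists_restrict_range_piChart h d hd μ
  refine ⟨c, hc, ?_⟩
  set E : (ι → Bool) → Set (∀ i, K i × K i) := fun S =>
    Set.univ.pi fun i => unitBall (K i) (S i) ×ˢ Set.univ with hE
  set Q := fun S : ι → Bool => piChart (piSwitch K S) '' E S with hQ
  have hEm : ∀ S, MeasurableSet (E S) := by
    intro S
    refine MeasurableSet.univ_pi fun i => MeasurableSet.prod ?_ MeasurableSet.univ
    unfold unitBall
    split_ifs
    · exact Metric.isOpen_ball.measurableSet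
    · exact Metric.isClosed_closedBall.measurableSet
  have hQm : ∀ S, MeasurableSet (Q S) := fun S =>
    (measurableEmbedding_piChart _).measurableSet_image.mpr (hEm S)
  have hcover : ⋃ S, Q S = Set.univ := by
    refine Set.eq_univ_of_forall fun y => ?_
    induction y using QuotientGroup.induction_on with | H g => ?_
    classical
    refine Set.mem_iUnion.mpr ⟨fun i => decide (‖g.1 0 0 i‖ < ‖g.1 1 0 i‖), ?_⟩
    exact (mk_mem_image_piChart _ g).mpr fun i => by simp
  have hdisj : Pairwise (Function.onFun Disjoint Q) := by
    intro S S' hne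
    refine Set.disjoint_left.mpr fun y hy hy' => hne ?_
    induction y using QuotientGroup.induction_on with | H g => ?_
    have h1 := (mk_mem_image_piChart S g).mp hy
    have h2 := (mk_mem_image_piChart S' g).mp hy'
    exact funext fun i => Bool.eq_iff_iff.mpr ((h1 i).trans (h2 i).symm)
  rw [← Measure.restrict_univ (μ := μ), ← hcover, Measure.restrict_iUnion hdisj hQm,
    Measure.sum_fintype, Finset.smul_sum]
  refine Finset.sum_congr rfl fun S _ => ?_
  have hw : piChart (piSwitch K S) = (fun y => piSwitch K S • y) ∘ piChart (K := K) 1 := by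
    ext p
    rw [Function.comp_apply, piChart_eq, piChart_eq, one_smul]
  have hwm : Measurable fun y : SpecialLinearGroup (Fin 2) (∀ i, K i) ⧸ diagTorus (∀ i, K i) =>
      piSwitch K S • y := (continuous_const_smul _).measurable
  have hpre : (fun y => piSwitch K S • y) ⁻¹' Q S = piChart (K := K) 1 '' E S := by
    rw [hQ]
    beta_reduce
    rw [hw, Set.image_comp, Set.preimage_image_eq _ (MulAction.injective _)]
  have hinv : μ.map (fun y => piSwitch K S • y) = μ := by
    refine Measure.ext fun s hs => ?_
    rw [Measure.map_apply hwm hs, measure_preimage_smul]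
  have hsub : piChart (K := K) 1 '' E S ⊆ Set.range (piChart 1) := Set.image_subset_range _ _
  -- Every piece is a Weyl translate of a subset of the standard chart, so invariance gives the same
  -- constant `c` on all of them.
  calc μ.restrict (Q S) = (μ.restrict (piChart (K := K) 1 '' E S)).map
        (fun y => piSwitch K S • y) := by
        conv_lhs => rw [← hinv]
        rw [Measure.restrict_map hwm (hQm S), hpre]
    _ = ((c • (Measure.pi fun i => (h i).prod (h i)).map (piChart 1)).restrict
          (piChart 1 '' E S)).map (fun y => piSwitch K S • y) := by
        rw [← hμ, Measure.restrict_restrict_of_subset hsub]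
    _ = _ := by
        rw [Measure.restrict_smul, Measure.map_smul,
          (measurableEmbedding_piChart 1).restrict_map,
          Set.preimage_image_eq _ (piChart_injective 1),
          Measure.map_map hwm (measurableEmbedding_piChart 1).measurable, ← hw, hE,
          Measure.restrict_pi_pi]
        simp only [← Measure.prod_restrict, Measure.restrict_univ]

end PiChart

/-! ### Local heights in the charts -/

section LocalFactor

variable {k : Type u} [Field k]

/-- The Weyl element or the identity, according to the value of the boolean, times a lower
unipotent element. -/
def switchLowerElt {F : Type*} [Field F] (b : Bool) (x : F) : SpecialLinearGroup (Fin 2) F :=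
  switchElt (if b then 1 else 0) (by split_ifs <;> simp) * lowerElt x

theorem continuous_switchLowerElt {F : Type*} [Field F] [TopologicalSpace F]
    [IsTopologicalRing F] (b : Bool) :
    Continuous (switchLowerElt b : F → SpecialLinearGroup (Fin 2) F) :=
  continuous_const.mul continuous_lowerElt

theorem continuous_evalAt (P : Matrix (Fin 3) (Fin 3) (MvPolynomial (Fin 2 × Fin 2) k))
    (R : Type u) [CommRing R] [Algebra k R] [TopologicalSpace R] [IsTopologicalRing R] :
    Continuous (evalAt P R) := by
  refine continuous_matrix fun i j => ?_
  have h : ∀ g : SpecialLinearGroup (Fin 2) R, evalAt P R g i j =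
      MvPolynomial.eval (fun p : Fin 2 × Fin 2 => g.1 p.1 p.2)
        (MvPolynomial.map (algebraMap k R) (P i j)) := by
    intro g
    rw [← MvPolynomial.eval₂_eq_eval_map]
    rfl
  simp_rw [h]
  refine (MvPolynomial.continuous_eval _).comp (continuous_pi fun p => ?_)
  exact continuous_subtype_val.matrix_elem _ _

/-- Apply an invertible matrix depending continuously on `x` to the line `x₀ + y w`. Its direction
stays nonzero, and its points lie in the orbit of `x₀ ≠ 0`, so they never vanish. -/
theorem SpinCover.lineFamily {q : QuadraticForm k (Fin 3 → k)} (ρ : SpinCover q)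
    {x₀ w : Fin 3 → k} (hx₀ : x₀ ≠ 0) (hw₀ : w ≠ 0)
    (hw : ∀ (R : Type u) [CommRing R] [Algebra k R] (z : R),
      ρ.act R (upperElt z) x₀ = fun i => algebraMap k R (x₀ i) + z * algebraMap k R (w i))
    (v : InfinitePlace k) (b : Bool) :
    LineFamily v 3 (fun x => ρ.act v.Completion (switchLowerElt b x) x₀)
      (fun x => evalAt ρ.poly v.Completion (switchLowerElt b x) *ᵥ
        fun i => algebraMap k v.Completion (w i)) ∧
    ∀ x y, ρ.act v.Completion (switchLowerElt b x * upperElt y) x₀ =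
      fun i => ρ.act v.Completion (switchLowerElt b x) x₀ i +
        y * (evalAt ρ.poly v.Completion (switchLowerElt b x) *ᵥ
          fun i => algebraMap k v.Completion (w i)) i := by
  have hact : ∀ x y, ρ.act v.Completion (switchLowerElt b x * upperElt y) x₀ =
      fun i => ρ.act v.Completion (switchLowerElt b x) x₀ i +
        y * (evalAt ρ.poly v.Completion (switchLowerElt b x) *ᵥ
          fun i => algebraMap k v.Completion (w i)) i := by
    intro x y
    rw [ρ.act_mul, hw]
    have : (fun i => algebraMap k v.Completion (x₀ i) + y * algebraMap k v.Completion (w i)) =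
        (fun i => algebraMap k v.Completion (x₀ i)) +
          y • fun i => algebraMap k v.Completion (w i) := rfl
    rw [this, Matrix.mulVec_add, Matrix.mulVec_smul]
    rfl
  have hc := (continuous_evalAt ρ.poly v.Completion).comp (continuous_switchLowerElt b)
  refine ⟨⟨hc.matrix_mulVec continuous_const, hc.matrix_mulVec continuous_const,
    fun x h0 => hw₀ ?_, fun x y => ?_⟩, hact⟩
  · have h1 := ρ.evalAt_mulVec_injective _ _ h0
    ext i
    exact (map_eq_zero (algebraMap k v.Completion)).mp (congrFun h1 i)
  · rw [← hact]
    exact ρ.act_ne_zero _ _ hx₀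

/-- Right multiplication by `n⁺(y)` adds `y` times the first column to the second; determinant one
keeps both nonzero. -/
theorem lineFamily_columns (v : InfinitePlace k) (b : Bool) :
    LineFamily v 2 (fun x i => (switchLowerElt b x).1 i 1)
      (fun x i => (switchLowerElt b x).1 i 0) := by
  have hc : ∀ i j, Continuous fun x : v.Completion => (switchLowerElt b x).1 i j := fun i j =>
    (continuous_subtype_val.comp (continuous_switchLowerElt b)).matrix_elem i j
  have hd : ∀ x : v.Completion, (switchLowerElt b x).1 0 0 * (switchLowerElt b x).1 1 1 -
      (switchLowerElt b x).1 0 1 * (switchLowerElt b x).1 1 0 = 1 := fun x => by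
    rw [← Matrix.det_fin_two]; exact (switchLowerElt b x).2
  refine ⟨continuous_pi fun i => hc i 1, continuous_pi fun i => hc i 0, fun x h => ?_,
    fun x y h => ?_⟩
  · have h0 := congrFun h 0
    have h1 := congrFun h 1
    have := hd x
    simp only [Pi.zero_apply] at h0 h1
    simp [h0, h1] at this
  · have h0 := congrFun h 0
    have h1 := congrFun h 1
    simp only [Pi.zero_apply] at h0 h1
    refine zero_ne_one (α := v.Completion) ?_
    linear_combination hd x + (switchLowerElt b x).1 1 0 * h0 - (switchLowerElt b x).1 0 0 * h1

theorem mul_upperElt_apply_zero {R : Type*} [CommRing R] (g : SpecialLinearGroup (Fin 2) R)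
    (y : R) (i : Fin 2) : (g * upperElt y).1 i 0 = g.1 i 0 := by
  change (g.1 * !![1, y; 0, 1]) i 0 = _
  simp [Matrix.mul_apply, Fin.sum_univ_two]

theorem mul_upperElt_apply_one {R : Type*} [CommRing R] (g : SpecialLinearGroup (Fin 2) R)
    (y : R) (i : Fin 2) : (g * upperElt y).1 i 1 = g.1 i 1 + y * g.1 i 0 := by
  change (g.1 * !![1, y; 0, 1]) i 1 = _
  simp [Matrix.mul_apply, Fin.sum_univ_two]
  ring

theorem measurableSet_unitBall (v : InfinitePlace k) (b : Bool) :
    MeasurableSet (unitBall v.Completion b) := by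
  unfold unitBall
  split_ifs
  · exact Metric.isOpen_ball.measurableSet
  · exact Metric.isClosed_closedBall.measurableSet

theorem unitBall_subset (v : InfinitePlace k) (b : Bool) :
    unitBall v.Completion b ⊆ Metric.closedBall 0 1 := by
  unfold unitBall
  split_ifs
  · exact Metric.ball_subset_closedBall
  · exact subset_rfl

theorem haarAt_unitBall_ne_zero (v : InfinitePlace k) (b : Bool) :
    haarAt v (unitBall v.Completion b) ≠ 0 := by
  unfold unitBall
  split_ifs
  · exact (Metric.measure_ball_pos _ _ one_pos).ne'
  · exact (Metric.measure_closedBall_pos _ _ one_pos).ne'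

end LocalFactor

/-! ### Assembly over the archimedean places -/

section Global

variable {k : Type u} [Field k]

variable (k) in
/-- The projection of `k_∞` to the completion at `v`. -/
noncomputable def projAt (v : InfinitePlace k) : InfiniteAdeleRing k →ₐ[k] v.Completion :=
  Pi.evalAlgHom k (fun v : InfinitePlace k => v.Completion) v

/-- The element of `G` with coordinates `(x_v, y_v)` in the chart translated by the Weyl elements
of the places in `S`. -/
noncomputable def chartElt (S : InfinitePlace k → Bool)
    (p : ∀ v : InfinitePlace k, v.Completion × v.Completion) : G k :=
  piSwitch (fun v : InfinitePlace k => v.Completion) S *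
    (lowerElt (fun v => (p v).1) * upperElt fun v => (p v).2)

theorem map_chartElt (S : InfinitePlace k → Bool)
    (p : ∀ v : InfinitePlace k, v.Completion × v.Completion) (v : InfinitePlace k) :
    SpecialLinearGroup.map (projAt k v : InfiniteAdeleRing k →+* v.Completion) (chartElt S p) =
      switchLowerElt (S v) (p v).1 * upperElt (p v).2 := by
  rw [switchLowerElt, mul_assoc]
  have h := map_switchElt (projAt k v : InfiniteAdeleRing k →+* v.Completion)
    (indic (fun v : InfinitePlace k => v.Completion) S) (indic_mul_self S)
  have h1 := map_lowerElt (projAt k v : InfiniteAdeleRing k →+* v.Completion) fun v => (p v).1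
  have h2 := map_upperElt (projAt k v : InfiniteAdeleRing k →+* v.Completion) fun v => (p v).2
  refine (map_mul _ _ _).trans (congrArg₂ _ h ((map_mul _ _ _).trans (congrArg₂ _ h1 h2)))

theorem chartElt_apply (S : InfinitePlace k → Bool)
    (p : ∀ v : InfinitePlace k, v.Completion × v.Completion) (v : InfinitePlace k) (i j : Fin 2) :
    (chartElt S p).1 i j v = (switchLowerElt (S v) (p v).1 * upperElt (p v).2).1 i j := by
  rw [← map_chartElt]
  rfl

theorem act_chartElt {q : QuadraticForm k (Fin 3 → k)} (ρ : SpinCover q) (x₀ : Fin 3 → k)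
    (S : InfinitePlace k → Bool)
    (p : ∀ v : InfinitePlace k, v.Completion × v.Completion) (v : InfinitePlace k) (i : Fin 3) :
    ρ.act (InfiniteAdeleRing k) (chartElt S p) x₀ i v =
      ρ.act v.Completion (switchLowerElt (S v) (p v).1 * upperElt (p v).2) x₀ i := by
  rw [← map_chartElt, ρ.act_map]
  rfl
variable [NumberField k]

theorem log_height {n : ℕ} (A : InfinitePlace k → Matrix (Fin n) (Fin n) ℂ)
    (x : Fin n → InfiniteAdeleRing k) (h : ∀ v, 0 < localNorm v (A v) fun i => x i v) :
    Real.log (height A x) =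
      ∑ v : InfinitePlace k, v.mult * Real.log (localNorm v (A v) fun i => x i v) := by
  rw [height, Real.log_prod fun v _ => (pow_pos (h v) _).ne']
  simp_rw [Real.log_pow]

theorem height_pos {n : ℕ} (A : InfinitePlace k → Matrix (Fin n) (Fin n) ℂ)
    (x : Fin n → InfiniteAdeleRing k) (h : ∀ v, 0 < localNorm v (A v) fun i => x i v) :
    0 < height A x :=
  Finset.prod_pos fun v _ => pow_pos (h v) _

theorem height_cpow {n : ℕ} (A : InfinitePlace k → Matrix (Fin n) (Fin n) ℂ)
    (x : Fin n → InfiniteAdeleRing k) (h : ∀ v, 0 < localNorm v (A v) fun i => x i v) (τ : ℂ) :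
    (height A x : ℂ) ^ (-τ) = ∏ v : InfinitePlace k,
      Complex.exp (-τ * (v.mult * Real.log (localNorm v (A v) fun i => x i v) : ℝ)) := by
  rw [Complex.cpow_def_of_ne_zero (by exact_mod_cast (height_pos A x h).ne'),
    ← Complex.ofReal_log (height_pos A x h).le, log_height A x h, ← Complex.exp_sum,
    Complex.ofReal_sum, ← Finset.mul_sum, mul_comm]

theorem measurableEmbedding_mk_chartElt [m : MeasurableSpace (G k ⧸ H k)]
    [b : BorelSpace (G k ⧸ H k)] (S : InfinitePlace k → Bool) :
    MeasurableEmbedding fun p => (QuotientGroup.mk (chartElt S p) : G k ⧸ H k) :=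
  @measurableEmbedding_piChart _ (fun v : InfinitePlace k => v.Completion) _ _ _ _ _ m b _

open Classical in
theorem exists_eq_smul_sum_map_chartElt
    [m : MeasurableSpace (G k ⧸ H k)] [b : BorelSpace (G k ⧸ H k)]
    (μ : Measure (G k ⧸ H k)) [hfin : IsFiniteMeasureOnCompacts μ]
    [hinv : SMulInvariantMeasure (G k) (G k ⧸ H k) μ] :
    ∃ c : ENNReal, c ≠ ⊤ ∧ μ = c • ∑ S : InfinitePlace k → Bool,
      (Measure.pi fun v => ((haarAt v).restrict (unitBall v.Completion (S v))).prod
        (haarAt v)).map fun p => (QuotientGroup.mk (chartElt S p) : G k ⧸ H k) :=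
  @exists_eq_smul_sum_map_piChart _ (fun v : InfinitePlace k => v.Completion) _ _ _ _ _ m b
    haarAt _ (fun v => v.mult) (fun v _ hr => haarAt_closedBall v hr) μ hfin hinv _

/-- The constant relating `μ` to the charts is nonzero because `μ` is, so the pole keeps its order
and the sign of its coefficient. -/
theorem HasPoleAtOne.of_charts [MeasurableSpace (G k ⧸ H k)] [BorelSpace (G k ⧸ H k)]
    {μ : Measure (G k ⧸ H k)} [IsFiniteMeasureOnCompacts μ]
    [SMulInvariantMeasure (G k) (G k ⧸ H k) μ] (hμ : μ ≠ 0) {f : ℂ → G k ⧸ H k → ℂ} {N : ℕ}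
    (h : ∀ S : InfinitePlace k → Bool, HasPoleAtOne
      (Measure.pi fun v => ((haarAt v).restrict (unitBall v.Completion (S v))).prod (haarAt v))
      (fun τ p => f τ (QuotientGroup.mk (chartElt S p))) N) : HasPoleAtOne μ f N := by
  classical
  obtain ⟨c, hc, hμc⟩ := exists_eq_smul_sum_map_chartElt μ
  have hc0 : c ≠ 0 := by
    rintro rfl
    exact hμ (by rw [hμc, zero_smul])
  rw [hμc]
  exact (HasPoleAtOne.sum_measure fun S => (h S).map (measurableEmbedding_mk_chartElt S)).smul_measure hc0 hc

end Global

end HeightZeta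

/-! ### The poles of `Z` and `Z_log` -/

theorem lemmaA1 {k : Type u} [Field k] [NumberField k]
    (q : QuadraticForm k (Fin 3 → k)) (hq : q.polarBilin.Nondegenerate)
    (m : k) (hm : m ≠ 0) (hdisc : IsSquare (-m * (HeightZeta.gramMatrix q).det))
    (ρ : HeightZeta.SpinCover q)
    (x₀ : Fin 3 → k) (hx₀ : q x₀ = m) (hstab : ρ.StabilizerIsTorus x₀)
    (A₂ : InfinitePlace k → Matrix (Fin 2) (Fin 2) ℂ) (hA₂ : ∀ v, (A₂ v).PosDef)
    (A₃ : InfinitePlace k → Matrix (Fin 3) (Fin 3) ℂ) (hA₃ : ∀ v, (A₃ v).PosDef)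
    [MeasurableSpace (HeightZeta.G k ⧸ HeightZeta.H k)]
    [BorelSpace (HeightZeta.G k ⧸ HeightZeta.H k)]
    (μ : Measure (HeightZeta.G k ⧸ HeightZeta.H k)) [μ.Regular]
    [SMulInvariantMeasure (HeightZeta.G k) (HeightZeta.G k ⧸ HeightZeta.H k) μ]
    (hμ : μ ≠ 0) :
    HeightZeta.ContinuesWithPole μ (HeightZeta.zetaLogIntegrand ρ x₀ hstab A₂ A₃)
        (InfinitePlace.nrRealPlaces k + InfinitePlace.nrComplexPlaces k + 1) ∧
      HeightZeta.ContinuesWithPole μ (HeightZeta.zetaIntegrand ρ x₀ hstab A₃)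
        (InfinitePlace.nrRealPlaces k + InfinitePlace.nrComplexPlaces k) := by
  open HeightZeta in
  have hx₀' : x₀ ≠ 0 := by
    rintro rfl
    exact hm (by rw [← hx₀, QuadraticMap.map_zero])
  obtain ⟨w, hw₀, hw⟩ := SpinCover.exists_act_upperElt hq ρ hx₀' hstab
  -- The order is counted as one simple pole for each archimedean place.
  rw [← InfinitePlace.card_eq_nrRealPlaces_add_nrComplexPlaces]
  have hlf := ρ.lineFamily hx₀' hw₀ hw
  have hZ : ∀ (S : InfinitePlace k → Bool) (v : InfinitePlace k), _ := fun S v =>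
    (hlf v (S v)).1.hasPoleAtOne (hA₃ v) (measurableSet_unitBall v (S v))
      (unitBall_subset v (S v)) (haarAt_unitBall_ne_zero v (S v))
  have hZl : ∀ (S : InfinitePlace k → Bool) (v : InfinitePlace k), _ := fun S v =>
    (hlf v (S v)).1.hasPoleAtOne_mul (hA₃ v) (lineFamily_columns v (S v)) (hA₂ v)
      (measurableSet_unitBall v (S v)) (unitBall_subset v (S v)) (haarAt_unitBall_ne_zero v (S v))
  have hfin : ∀ (S : InfinitePlace k → Bool) (v : InfinitePlace k),
      IsFiniteMeasure ((haarAt v).restrict (unitBall v.Completion (S v))) := fun S v =>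
    isFiniteMeasure_restrict.mpr
      (measure_ne_top_of_subset (unitBall_subset v (S v)) measure_closedBall_lt_top.ne)
  have hint : ∀ (S : InfinitePlace k → Bool) (τ : ℂ) (p : ∀ v, v.Completion × v.Completion),
      zetaIntegrand ρ x₀ hstab A₃ τ (QuotientGroup.mk (chartElt S p)) = ∏ v : InfinitePlace k,
        Complex.exp (-τ * (v.mult * Real.log (localNorm v (A₃ v) fun i =>
          ρ.act v.Completion (switchLowerElt (S v) (p v).1) x₀ i +
            (p v).2 * (evalAt ρ.poly v.Completion (switchLowerElt (S v) (p v).1) *ᵥ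
              fun i => algebraMap k v.Completion (w i)) i) : ℝ)) := by
    intro S τ p
    have h1 : ∀ v : InfinitePlace k, (fun i => orbitMap ρ x₀ hstab
        (QuotientGroup.mk (chartElt S p)) i v) = fun i =>
        ρ.act v.Completion (switchLowerElt (S v) (p v).1) x₀ i +
          (p v).2 * (evalAt ρ.poly v.Completion (switchLowerElt (S v) (p v).1) *ᵥ
            fun i => algebraMap k v.Completion (w i)) i := by
      intro v
      rw [← (hlf v (S v)).2]
      ext1 i
      exact act_chartElt ρ x₀ S p v i
    rw [zetaIntegrand, height_cpow]
    · simp_rw [h1]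
    · intro v
      rw [h1]
      exact localNorm_pos v (hA₃ v) ((hlf v (S v)).1.ne_zero _ _)
  have hlog : ∀ (S : InfinitePlace k → Bool) (p : ∀ v, v.Completion × v.Completion),
      Real.log (cosetT A₂ (QuotientGroup.mk (chartElt S p))) = ∑ v : InfinitePlace k,
        v.mult * (Real.log (localNorm v (A₂ v) fun i => (switchLowerElt (S v) (p v).1).1 i 0) +
          Real.log (localNorm v (A₂ v) fun i => (switchLowerElt (S v) (p v).1).1 i 1 +
            (p v).2 * (switchLowerElt (S v) (p v).1).1 i 0)) := by
    intro S p
    have h0 : ∀ v : InfinitePlace k, (fun i => ((chartElt S p).1 *ᵥ Pi.single 0 1) i v) =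
        fun i => (switchLowerElt (S v) (p v).1).1 i 0 := by
      intro v
      ext1 i
      rw [Matrix.mulVec_single_one]
      exact (chartElt_apply S p v i 0).trans (mul_upperElt_apply_zero _ _ _)
    have h1 : ∀ v : InfinitePlace k, (fun i => ((chartElt S p).1 *ᵥ Pi.single 1 1) i v) =
        fun i => (switchLowerElt (S v) (p v).1).1 i 1 +
            (p v).2 * (switchLowerElt (S v) (p v).1).1 i 0 := by
      intro v
      ext1 i
      rw [Matrix.mulVec_single_one]
      exact (chartElt_apply S p v i 1).trans (mul_upperElt_apply_one _ _ _)
    have hp0 : ∀ v, 0 < localNorm v (A₂ v) fun i => ((chartElt S p).1 *ᵥ Pi.single 0 1) i v :=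
      fun v => by
        rw [h0]
        exact localNorm_pos v (hA₂ v) ((lineFamily_columns v (S v)).right_ne_zero _)
    have hp1 : ∀ v, 0 < localNorm v (A₂ v) fun i => ((chartElt S p).1 *ᵥ Pi.single 1 1) i v :=
      fun v => by
        rw [h1]
        exact localNorm_pos v (hA₂ v) ((lineFamily_columns v (S v)).ne_zero _ _)
    change Real.log (height A₂ _ * height A₂ _) = _
    rw [Real.log_mul (height_pos A₂ _ hp0).ne' (height_pos A₂ _ hp1).ne', log_height A₂ _ hp0,
      log_height A₂ _ hp1, ← Finset.sum_add_distrib]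
    simp_rw [h0, h1, mul_add]
  constructor
  · refine (HasPoleAtOne.of_charts hμ fun S =>
      (HasPoleAtOne.pi_sum (hZ S) (hZl S)).congr fun τ => ae_of_all _ fun p => ?_).continuesWithPole
    change _ = ((Real.log (cosetT A₂ _) : ℝ) : ℂ) * zetaIntegrand ρ x₀ hstab A₃ τ _
    rw [hint, hlog]
  · have h := fun S => HasPoleAtOne.pi (hZ S)
    simp only [Finset.sum_const, Finset.card_univ, smul_eq_mul, mul_one] at h
    refine (HasPoleAtOne.of_charts hμ fun S =>
      (h S).congr fun τ => ae_of_all _ fun p => ?_).continuesWithPole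
    exact (hint S τ p).symm
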